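/- **Theorem.** There is a polynomial-time $1.45$-approximation algorithm for maximizing Nash social welfare under additive valuations. Precisely: an instance consists of $n\ge 1$ agents, $m\ge 0$ indivisible goods and non-negative integers $v_{i,j}$ ($i\in[n]$, $j\in[m]$); agent $i$ values a set $S$ of goods at $v_i(S)=\sum_{j\in S}v_{i,j}$. An allocation is a partition $\mathbf x=(\mathbf x_1,\dots,\mathbf x_n)$ of $[m]$ into (possibly empty) bundles, and its Nash social welfare is $\mathrm{NSW}(\mathbf x)=\bigl(\prod_{i=1}^n v_i(\mathbf x_i)\bigr)^{1/n}$. There are a deterministic algorithm (a fixed program for a random access machine with logarithmic cost, that is, each arithmetic operation and each memory access is charged one plus the bit lengths of the operands and addresses involved) and a polynomial $p$ such that on every instance, given by $n$, $m$ and the matrix $(v_{i,j})$, the algorithm halts within time $p(L)$, where $L=n+m+\sum_{i,j}(\text{number of binary digits of }v_{i,j})$ (the number $0$ being counted as having no digits), and outputs an allocation $\mathbf x$ with $$\mathrm{NSW}(\mathbf x)\;\ge\;\frac{1}{1.45}\,\max_{\mathbf y}\mathrm{NSW}(\mathbf y),$$ where the maximum is over all allocations $\mathbf y$. -/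

import Mathlib

/-! ## A random access machine with logarithmic cost

Programs are structured (assignments, sequencing, conditionals and loops) and act on a store of
natural numbers: scalar variables and arrays, of which a program can name only finitely many.
Every arithmetic operation and every memory access is charged the bit lengths of the numbers
(and of the address) that it handles, plus one. -/

namespace RAM

/-- The store: the content of each scalar variable and of each cell of each array. -/
structure Store where
  var : ℕ → ℕ
  arr : ℕ → ℕ → ℕ

/-- The arithmetic operations of the machine. -/
inductive BinOp
  | add | sub | mul | div | mod | lt | eq

/-- Subtraction is truncated at zero, division rounds down, and a comparison gives `1` for true
and `0` for false. -/
def BinOp.apply : BinOp → ℕ → ℕ → ℕ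
  | .add, a, b => a + b
  | .sub, a, b => a - b
  | .mul, a, b => a * b
  | .div, a, b => a / b
  | .mod, a, b => a % b
  | .lt, a, b => if a < b then 1 else 0
  | .eq, a, b => if a = b then 1 else 0

/-- Expressions: constants, scalar variables, array cells, and arithmetic operations. -/
inductive Expr
  | const (c : ℕ)
  | var (x : ℕ)
  | get (a : ℕ) (e : Expr)
  | op (o : BinOp) (e₁ e₂ : Expr)

/-- The value of an expression in a store. -/
def Expr.eval (s : Store) : Expr → ℕ
  | .const c => c
  | .var x => s.var x
  | .get a e => s.arr a (e.eval s)
  | .op o e₁ e₂ => o.apply (e₁.eval s) (e₂.eval s)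

/-- The time for evaluating an expression. `Nat.size` is the number of binary digits. -/
def Expr.cost (s : Store) : Expr → ℕ
  | .const c => 1 + c.size
  | .var x => 1 + (s.var x).size
  | .get a e => e.cost s + (1 + (e.eval s).size + (s.arr a (e.eval s)).size)
  | .op _ e₁ e₂ => e₁.cost s + e₂.cost s + (1 + (e₁.eval s).size + (e₂.eval s).size)

/-- Programs. A condition is true when its value is nonzero. -/
inductive Program
  | skip
  | assign (x : ℕ) (e : Expr)
  | store (a : ℕ) (i e : Expr)
  | seq (P Q : Program)
  | ite (e : Expr) (P Q : Program)
  | loop (e : Expr) (P : Program)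

/-- The store after the value `v` has been written to the variable `x`. -/
def Store.setVar (s : Store) (x v : ℕ) : Store :=
  { s with var := Function.update s.var x v }

/-- The store after the value `v` has been written to cell `i` of the array `a`. -/
def Store.setArr (s : Store) (a i v : ℕ) : Store :=
  { s with arr := Function.update s.arr a (Function.update (s.arr a) i v) }

/-- `Run P s t s'`: started in the store `s`, the program `P` halts after time `t` in the
store `s'`. -/
inductive Run : Program → Store → ℕ → Store → Prop
  | skip (s : Store) : Run .skip s 1 s
  | assign (s : Store) (x : ℕ) (e : Expr) :
      Run (.assign x e) s (e.cost s + (1 + (e.eval s).size)) (s.setVar x (e.eval s))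
  | store (s : Store) (a : ℕ) (i e : Expr) :
      Run (.store a i e) s
        (i.cost s + e.cost s + (1 + (i.eval s).size + (e.eval s).size))
        (s.setArr a (i.eval s) (e.eval s))
  | seq {P Q : Program} {s s' s'' : Store} {t t' : ℕ} :
      Run P s t s' → Run Q s' t' s'' → Run (.seq P Q) s (t + t') s''
  | ite_true {e : Expr} {P Q : Program} {s s' : Store} {t : ℕ} :
      e.eval s ≠ 0 → Run P s t s' → Run (.ite e P Q) s (e.cost s + t) s'
  | ite_false {e : Expr} {P Q : Program} {s s' : Store} {t : ℕ} :
      e.eval s = 0 → Run Q s t s' → Run (.ite e P Q) s (e.cost s + t) s'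
  | loop_done {e : Expr} {P : Program} {s : Store} :
      e.eval s = 0 → Run (.loop e P) s (e.cost s) s
  | loop_step {e : Expr} {P : Program} {s s' s'' : Store} {t t' : ℕ} :
      e.eval s ≠ 0 → Run P s t s' → Run (.loop e P) s' t' s'' →
      Run (.loop e P) s (e.cost s + t + t') s''

/-- The machine is deterministic: the running time and the final store are determined by the
program and the initial store. -/
theorem Run.deterministic {P : Program} {s s₁ s₂ : Store} {t₁ t₂ : ℕ}
    (h₁ : Run P s t₁ s₁) (h₂ : Run P s t₂ s₂) : t₁ = t₂ ∧ s₁ = s₂ := by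
  induction h₁ generalizing t₂ s₂ with
  | skip s => cases h₂; exact ⟨rfl, rfl⟩
  | assign s x e => cases h₂; exact ⟨rfl, rfl⟩
  | store s a i e => cases h₂; exact ⟨rfl, rfl⟩
  | seq _ _ ih ih' =>
    cases h₂ with
    | seq g g' =>
      obtain ⟨rfl, rfl⟩ := ih g
      obtain ⟨rfl, rfl⟩ := ih' g'
      exact ⟨rfl, rfl⟩
  | ite_true he _ ih =>
    cases h₂ with
    | ite_true _ g =>
      obtain ⟨rfl, rfl⟩ := ih g
      exact ⟨rfl, rfl⟩
    | ite_false hf _ => exact absurd hf he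
  | ite_false he _ ih =>
    cases h₂ with
    | ite_true hf _ => exact absurd he hf
    | ite_false _ g =>
      obtain ⟨rfl, rfl⟩ := ih g
      exact ⟨rfl, rfl⟩
  | loop_done he =>
    cases h₂ with
    | loop_done _ => exact ⟨rfl, rfl⟩
    | loop_step hf _ _ => exact absurd he hf
  | loop_step he _ _ ih ih' =>
    cases h₂ with
    | loop_done hf => exact absurd hf he
    | loop_step _ g g' =>
      obtain ⟨rfl, rfl⟩ := ih g
      obtain ⟨rfl, rfl⟩ := ih' g'
      exact ⟨rfl, rfl⟩

end RAM

/-! ## Fair division of indivisible goods -/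

/-- An instance of the fair division problem with additive valuations: `n` agents (at least one),
`m` indivisible goods, and the value `v i j` of the good `j` for the agent `i`. -/
structure FairDivision where
  n : ℕ
  m : ℕ
  n_pos : 0 < n
  v : Fin n → Fin m → ℕ

namespace FairDivision

/-- The additive valuation of agent `i` on sets of goods. -/
def value (I : FairDivision) (i : Fin I.n) (S : Finset (Fin I.m)) : ℕ :=
  ∑ j ∈ S, I.v i j

/-- An (integral) allocation, that is, a partition of the goods into one (possibly empty) bundle
for each agent, given by the owner of each good. -/
abbrev Allocation (I : FairDivision) : Type := Fin I.m → Fin I.n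

/-- The bundle of agent `i`. -/
def bundle (I : FairDivision) (x : I.Allocation) (i : Fin I.n) : Finset (Fin I.m) :=
  Finset.univ.filter fun j => x j = i

/-- Nash social welfare: the geometric mean of the agents' values for their own bundles. -/
noncomputable def nsw (I : FairDivision) (x : I.Allocation) : ℝ :=
  (∏ i, (I.value i (I.bundle x i) : ℝ)) ^ (1 / (I.n : ℝ))

/-- The length of the input: the numbers of agents and of goods, plus the total number of binary
digits of the valuations. -/
def inputLength (I : FairDivision) : ℕ :=
  I.n + I.m + ∑ i, ∑ j, (I.v i j).size

/-- The input as the machine receives it: variable `0` holds `n`, variable `1` holds `m`,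
array `0` holds the matrix of valuations row by row, and everything else is zero. -/
def input (I : FairDivision) : RAM.Store where
  var x := if x = 0 then I.n else if x = 1 then I.m else 0
  arr a k :=
    if a = 0 then
      if h : k / I.m < I.n ∧ k % I.m < I.m then I.v ⟨k / I.m, h.1⟩ ⟨k % I.m, h.2⟩ else 0
    else 0

/-- The output convention: cell `j` of array `1` holds the owner of the good `j`. -/
def IsOutput (I : FairDivision) (s : RAM.Store) (x : I.Allocation) : Prop :=
  ∀ j : Fin I.m, s.arr 1 j = (x j : ℕ)

end FairDivision

/-! The algorithm is an auction whose final states are analysed through prices. First every `v i j`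
is replaced by `K * v i j + 1000` with a huge `K`, so that all values are positive. Each good starts
with an agent that values it most, priced at that value. While some agent spends less than a common
target `T`, it takes a good of its best value-to-price ratio, whose price grows by a factor between
1.001 and 1.002. If nobody is below `T`, but somebody's bundle costs more than `T` even without its
most expensive good, then `T` grows instead. In a final state every bundle costs at least `T`, and
at most `T` plus its top price; moreover every agent owns only goods within a factor 1.002 of its
best ratio (`Inv.best`).

Rescaling agent by agent, this last property allows prices to be compared instead of values, at the
cost of 1.002 per agent (`prod_value_le`). For prices, let `capLog` be the function that follows the
tangent `u / e` of the logarithm up to `e`, and the logarithm afterwards. It majorizes the logarithm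
and is subadditive, so for any allocation the sum of the logarithms of bundle price over `T` is at
most the sum of `capLog (p j / T)` over all goods, a quantity that does not mention the allocation.
On a final bundle the reverse inequality holds up to `1 / e` (`capLog_sum_goods_le`). Hence the
final state is within `exp (1 / e) < 1.4447` per agent of every other allocation (`prod_price_le`).
The perturbation costs a factor 1.001 (`prod_value_le_of_perturbed`), and `1.4447 * 1.002 * 1.001 <
1.45`.

The auction ends because each step multiplies the potential, the target times all prices, by at
least 1.001, while `Inv` bounds target and prices. The point is that whenever somebody bids, some
good is cheap (`Inv.exists_price_le`); a best-ratio good then cannot be expensive, because values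
lie between 1 and `U`. This needs at least as many goods as agents; otherwise every welfare is zero.

For the running time, the program is written with bounded loops that store only expressions a
constant number of digits longer than the existing entries. Lengths then grow by at most a
polynomial in the loop bounds, and the cost is polynomial by induction on the command
(`Cmd.run_compile`). -/

namespace RAM

/-! ### Stores with entries of bounded length -/

/-- Every entry of the store has at most `W` binary digits. -/
def Store.Small (s : Store) (W : ℕ) : Prop :=
  (∀ y, (s.var y).size ≤ W) ∧ ∀ a k, (s.arr a k).size ≤ W

theorem Store.Small.mono {s : Store} {W W' : ℕ} (h : s.Small W) (hW : W ≤ W') : s.Small W' :=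
  ⟨fun y => (h.1 y).trans hW, fun a k => (h.2 a k).trans hW⟩

theorem Store.Small.setVar {s : Store} {W : ℕ} (h : s.Small W) (x : ℕ) {v : ℕ}
    (hv : v.size ≤ W) : (s.setVar x v).Small W := by
  refine ⟨fun y => ?_, h.2⟩
  by_cases hy : y = x
  · subst hy; simpa [Store.setVar] using hv
  · simpa [Store.setVar, hy] using h.1 y

theorem Store.Small.setArr {s : Store} {W : ℕ} (h : s.Small W) (a i : ℕ) {v : ℕ}
    (hv : v.size ≤ W) : (s.setArr a i v).Small W := by
  refine ⟨h.1, fun b k => ?_⟩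
  by_cases hb : b = a
  · subst hb
    by_cases hk : k = i
    · subst hk; simpa [Store.setArr] using hv
    · simpa [Store.setArr, hk] using h.2 b k
  · simpa [Store.setArr, hb] using h.2 b k

@[simp] theorem Store.setVar_var (s : Store) (x v y : ℕ) :
    (s.setVar x v).var y = if y = x then v else s.var y := by
  simp [Store.setVar, Function.update_apply]

@[simp] theorem Store.setVar_arr (s : Store) (x v : ℕ) : (s.setVar x v).arr = s.arr := rfl

@[simp] theorem Store.setArr_var (s : Store) (a i v : ℕ) : (s.setArr a i v).var = s.var := rfl

@[simp] theorem Store.setArr_arr (s : Store) (a i v b : ℕ) :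
    (s.setArr a i v).arr b = if b = a then Function.update (s.arr a) i v else s.arr b := by
  by_cases h : b = a
  · subst h; simp [Store.setArr]
  · simp [Store.setArr, h]

theorem Store.ext {s s' : Store} (hv : ∀ y, s.var y = s'.var y) (ha : s.arr = s'.arr) :
    s = s' := by
  cases s; cases s'
  simp only [Store.mk.injEq]
  exact ⟨funext hv, ha⟩

/-! ### The length of values and the cost of expressions -/

theorem size_add_le (a b : ℕ) : (a + b).size ≤ max a.size b.size + 1 := by
  rw [Nat.size_le]
  have ha : a < 2 ^ max a.size b.size :=
    (Nat.lt_size_self a).trans_le (Nat.pow_le_pow_right two_pos (le_max_left _ _))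
  have hb : b < 2 ^ max a.size b.size :=
    (Nat.lt_size_self b).trans_le (Nat.pow_le_pow_right two_pos (le_max_right _ _))
  rw [pow_succ]; omega

theorem size_mul_le (a b : ℕ) : (a * b).size ≤ a.size + b.size := by
  rw [Nat.size_le, pow_add]
  exact Nat.mul_lt_mul'' (Nat.lt_size_self a) (Nat.lt_size_self b)

theorem size_self_le (a : ℕ) : a.size ≤ a := Nat.size_le.2 Nat.lt_two_pow_self

theorem size_div_two {v : ℕ} (hv : v ≠ 0) : v.size = (v / 2).size + 1 := by
  conv_lhs => rw [← Nat.bit_bodd_div2 v]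
  rw [Nat.size_bit (by rwa [Nat.bit_bodd_div2]), Nat.div2_val]

/-- The value of an expression has at most `e.deg * (W + 1)` digits. -/
def Expr.deg : Expr → ℕ
  | .const c => c.size
  | .var _ => 1
  | .get _ _ => 1
  | .op _ e₁ e₂ => e₁.deg + e₂.deg + 1

/-- The cost of an expression is at most `e.weight * (W + 1)`. -/
def Expr.weight : Expr → ℕ
  | .const c => 1 + c.size
  | .var _ => 1
  | .get _ e => e.weight + e.deg + 1
  | .op _ e₁ e₂ => e₁.weight + e₂.weight + e₁.deg + e₂.deg + 1

/-- The expressions whose values are longer than the entries of the store by at most a constant. -/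
def Expr.mild : Expr → Bool
  | .const _ => true
  | .var _ => true
  | .get _ _ => true
  | .op .add e₁ e₂ => e₁.mild && e₂.mild
  | .op .sub e₁ _ => e₁.mild
  | .op .div e₁ _ => e₁.mild
  | .op .mod e₁ _ => e₁.mild
  -- Repeatedly storing products would let lengths double in each iteration. Products remain allowed
  -- in addresses and in conditions, where nothing is stored.
  | .op .mul _ _ => false
  | .op .lt _ _ => true
  | .op .eq _ _ => true

/-- The number of digits by which the value of a mild expression can exceed the entries of the
store. -/
def Expr.grow : Expr → ℕ
  | .const c => c.size
  | .var _ => 0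
  | .get _ _ => 0
  | .op .add e₁ e₂ => e₁.grow + e₂.grow + 1
  | .op .sub e₁ _ => e₁.grow
  | .op .div e₁ _ => e₁.grow
  | .op .mod e₁ _ => e₁.grow
  | .op .mul _ _ => 0
  | .op .lt _ _ => 1
  | .op .eq _ _ => 1

theorem size_ite_le (p : Prop) [Decidable p] : (if p then 1 else 0 : ℕ).size ≤ 1 := by
  split <;> simp

theorem BinOp.size_apply_le (o : BinOp) (a b : ℕ) : (o.apply a b).size ≤ a.size + b.size + 1 := by
  cases o
  · have := size_add_le a b; simp only [BinOp.apply]; omega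
  · have := Nat.size_le_size (Nat.sub_le a b); simp only [BinOp.apply]; omega
  · have := size_mul_le a b; simp only [BinOp.apply]; omega
  · have := Nat.size_le_size (Nat.div_le_self a b); simp only [BinOp.apply]; omega
  · have := Nat.size_le_size (Nat.mod_le a b); simp only [BinOp.apply]; omega
  · have := size_ite_le (a < b); simp only [BinOp.apply]; omega
  · have := size_ite_le (a = b); simp only [BinOp.apply]; omega

theorem Expr.size_eval_le {s : Store} {W : ℕ} (hs : s.Small W) (e : Expr) :
    (e.eval s).size ≤ e.deg * (W + 1) := by
  induction e with
  | const c => simp only [eval, deg]; nlinarith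
  | var x => simp only [eval, deg]; have := hs.1 x; omega
  | get a e _ => simp only [eval, deg]; have := hs.2 a (e.eval s); omega
  | op o e₁ e₂ h₁ h₂ =>
    simp only [eval, deg]
    have := o.size_apply_le (e₁.eval s) (e₂.eval s)
    rw [add_mul, add_mul]; omega

theorem Expr.cost_le {s : Store} {W : ℕ} (hs : s.Small W) (e : Expr) :
    e.cost s ≤ e.weight * (W + 1) := by
  induction e with
  | const c => simp only [cost, weight]; nlinarith
  | var x => simp only [cost, weight]; have := hs.1 x; omega
  | get a e h =>
    simp only [cost, weight]
    have := hs.2 a (e.eval s)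
    have := e.size_eval_le hs
    rw [add_mul, add_mul]; omega
  | op o e₁ e₂ h₁ h₂ =>
    simp only [cost, weight]
    have := e₁.size_eval_le hs
    have := e₂.size_eval_le hs
    simp only [add_mul]; omega

theorem Expr.size_eval_le_of_mild {s : Store} {W : ℕ} (hs : s.Small W) (e : Expr)
    (he : e.mild = true) : (e.eval s).size ≤ W + e.grow := by
  induction e with
  | const c => simp [eval, grow]
  | var x => simpa [eval, grow] using hs.1 x
  | get a e _ => simpa [eval, grow] using hs.2 a (e.eval s)
  | op o e₁ e₂ h₁ h₂ =>
    cases o <;> simp only [mild, Bool.and_eq_true, reduceCtorEq] at he <;>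
      simp only [eval, grow, BinOp.apply]
    · have := size_add_le (e₁.eval s) (e₂.eval s)
      have := h₁ he.1
      have := h₂ he.2
      omega
    · exact (Nat.size_le_size (Nat.sub_le _ _)).trans (h₁ he)
    · exact (Nat.size_le_size (Nat.div_le_self _ _)).trans (h₁ he)
    · exact (Nat.size_le_size (Nat.mod_le _ _)).trans (h₁ he)
    · exact (size_ite_le _).trans (by omega)
    · exact (size_ite_le _).trans (by omega)

/-! ### A language of bounded loops -/

/-- Commands with bounded loops: `rep x y c` runs `c` with `x` counting down from the value of the
variable `y` (exclusive) to zero, and `size x y` puts the length of `y` into `x` and clears `y`. -/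
inductive Cmd
  | skip
  | assign (x : ℕ) (e : Expr)
  | store (a : ℕ) (i e : Expr)
  | seq (c d : Cmd)
  | ite (e : Expr) (c d : Cmd)
  | rep (x y : ℕ) (c : Cmd)
  | size (x y : ℕ)

/-- The iteration of `f` with a variable that counts down. -/
def countdown (f : Store → Store) (x : ℕ) : ℕ → Store → Store
  | 0, s => s
  | k + 1, s => countdown f x k (f (s.setVar x k))

namespace Cmd

/-- The effect of a command on the store. -/
def denote : Cmd → Store → Store
  | skip, s => s
  | assign x e, s => s.setVar x (e.eval s)
  | store a i e, s => s.setArr a (i.eval s) (e.eval s)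
  | seq c d, s => d.denote (c.denote s)
  | ite e c d, s => if e.eval s ≠ 0 then c.denote s else d.denote s
  | rep x y c, s => countdown c.denote x (s.var y) (s.setVar x (s.var y))
  | size x y, s => (s.setVar x (s.var y).size).setVar y 0

/-- The translation into programs. -/
def compile : Cmd → Program
  | skip => .skip
  | assign x e => .assign x e
  | store a i e => .store a i e
  | seq c d => .seq c.compile d.compile
  | ite e c d => .ite e c.compile d.compile
  | rep x y c => .seq (.assign x (.var y))
      (.loop (.var x) (.seq (.assign x (.op .sub (.var x) (.const 1))) c.compile))
  | size x y => .seq (.assign x (.const 0))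
      (.loop (.var y) (.seq (.assign y (.op .div (.var y) (.const 2)))
        (.assign x (.op .add (.var x) (.const 1)))))

/-- The variables that a command may change. -/
def wv : Cmd → List ℕ
  | skip => []
  | assign x _ => [x]
  | store _ _ _ => []
  | seq c d => c.wv ++ d.wv
  | ite _ c d => c.wv ++ d.wv
  | rep x _ c => x :: c.wv
  | size x y => [x, y]

/-- The arrays that a command may change. -/
def wa : Cmd → List ℕ
  | skip => []
  | assign _ _ => []
  | store a _ _ => [a]
  | seq c d => c.wa ++ d.wa
  | ite _ c d => c.wa ++ d.wa
  | rep _ _ c => c.wa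
  | size _ _ => []

/-- The variables that bound the loops of a command. -/
def bounds : Cmd → List ℕ
  | skip => []
  | assign _ _ => []
  | store _ _ _ => []
  | seq c d => c.bounds ++ d.bounds
  | ite _ c d => c.bounds ++ d.bounds
  | rep _ y c => y :: c.bounds
  | size _ _ => []

/-- Stored expressions are mild, and neither loop counters nor loop bounds are overwritten. -/
def wf : Cmd → Bool
  | skip => true
  | assign _ e => e.mild
  | store _ _ e => e.mild
  -- The bounds of `d` must keep their initial values, so that a single number `N`, read off the
  -- initial store, bounds all loops.
  | seq c d => c.wf && d.wf && d.bounds.all fun y => !c.wv.contains y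
  | ite _ c d => c.wf && d.wf
  | rep x _ c => c.wf && (!c.wv.contains x) && (c.bounds.all fun y => !(x :: c.wv).contains y)
  | size x y => x != y

/-! ### Frame property and loop invariants -/

/-- `s'` differs from `s` only where `c` may write. -/
def Agree (c : Cmd) (s s' : Store) : Prop :=
  (∀ y, y ∉ c.wv → s'.var y = s.var y) ∧ ∀ a, a ∉ c.wa → s'.arr a = s.arr a

theorem Agree.rep_step {c : Cmd} (hc : ∀ s, c.Agree s (c.denote s)) {x y k : ℕ} {s₀ s : Store}
    (hs : (rep x y c).Agree s₀ s) : (rep x y c).Agree s₀ (c.denote (s.setVar x k)) := by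
  refine ⟨fun z hz => ?_, fun a ha => ?_⟩
  · have hz' := hz
    simp only [wv, List.mem_cons, not_or] at hz'
    rw [(hc _).1 z hz'.2, Store.setVar_var, if_neg hz'.1, hs.1 z hz]
  · rw [(hc _).2 a ha, Store.setVar_arr, hs.2 a ha]

theorem agree_countdown {c : Cmd} (hc : ∀ s, c.Agree s (c.denote s)) (x y k : ℕ) (s₀ s : Store)
    (hs : (rep x y c).Agree s₀ s) : (rep x y c).Agree s₀ (countdown c.denote x k s) := by
  induction k generalizing s with
  | zero => exact hs
  | succ k ih => exact ih _ (hs.rep_step hc)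

theorem agree_rep_init (c : Cmd) (x y v : ℕ) (s : Store) : (rep x y c).Agree s (s.setVar x v) := by
  refine ⟨fun z hz => ?_, fun a _ => rfl⟩
  simp only [wv, List.mem_cons, not_or] at hz
  rw [Store.setVar_var, if_neg hz.1]

/-- A command changes the store only where it may write. -/
theorem agree_denote (c : Cmd) (s : Store) : c.Agree s (c.denote s) := by
  induction c generalizing s with
  | skip => exact ⟨fun _ _ => rfl, fun _ _ => rfl⟩
  | assign x e =>
    refine ⟨fun y hy => ?_, fun _ _ => rfl⟩
    simp only [wv, List.mem_singleton] at hy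
    simp [denote, hy]
  | store a i e =>
    refine ⟨fun _ _ => rfl, fun b hb => ?_⟩
    simp only [wa, List.mem_singleton] at hb
    simp [denote, hb]
  | seq c d hc hd =>
    refine ⟨fun y hy => ?_, fun a ha => ?_⟩
    · simp only [wv, List.mem_append, not_or] at hy
      simp only [denote]
      rw [(hd _).1 y hy.2, (hc _).1 y hy.1]
    · simp only [wa, List.mem_append, not_or] at ha
      simp only [denote]
      rw [(hd _).2 a ha.2, (hc _).2 a ha.1]
  | ite e c d hc hd =>
    refine ⟨fun y hy => ?_, fun a ha => ?_⟩
    · simp only [wv, List.mem_append, not_or] at hy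
      simp only [denote]
      split
      exacts [(hc _).1 y hy.1, (hd _).1 y hy.2]
    · simp only [wa, List.mem_append, not_or] at ha
      simp only [denote]
      split
      exacts [(hc _).2 a ha.1, (hd _).2 a ha.2]
  | rep x y c hc => exact agree_countdown hc x y _ s _ (agree_rep_init c x y _ s)
  | size x y =>
    refine ⟨fun z hz => ?_, fun _ _ => rfl⟩
    simp only [wv, List.mem_cons, List.not_mem_nil, or_false, not_or] at hz
    simp [denote, hz.1, hz.2]

/-- The invariant rule for loops. -/
theorem rep_induction {x y : ℕ} {c : Cmd} {s : Store} (Inv : ℕ → Store → Prop)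
    (h₀ : Inv (s.var y) (s.setVar x (s.var y)))
    (h : ∀ k < s.var y, ∀ s', (rep x y c).Agree s s' → Inv (k + 1) s' →
      Inv k (c.denote (s'.setVar x k))) :
    Inv 0 ((rep x y c).denote s) := by
  suffices H : ∀ k ≤ s.var y, ∀ s', (rep x y c).Agree s s' → Inv k s' →
      Inv 0 (countdown c.denote x k s') from
    H _ le_rfl _ (agree_rep_init c x y _ s) h₀
  intro k
  induction k with
  | zero => intro _ s' _ h'; exact h'
  | succ k ih =>
    intro hk s' hs' h'
    exact ih (by omega) _ (hs'.rep_step (agree_denote c)) (h k (by omega) s' hs' h')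

/-! ### Commands run in polynomial time -/

open Polynomial in
/-- A bound for the increase in length of the entries of the store, in terms of a bound for the
loop bounds. -/
noncomputable def growth : Cmd → ℕ[X]
  | skip => 0
  | assign _ e => C e.grow
  | store _ _ e => C e.grow
  | seq c d => c.growth + d.growth
  | ite _ c d => c.growth + d.growth
  | rep _ _ c => X * c.growth
  | size _ _ => 0

open Polynomial in
/-- A bound for the running time, in terms of a bound for the loop bounds and for the lengths of
the entries of the store. -/
noncomputable def time : Cmd → ℕ[X]
  | skip => 1
  | assign _ e => C (e.weight + e.deg + 1) * (X + 1)
  | store _ i e => C (i.weight + e.weight + i.deg + e.deg + 1) * (X + 1)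
  | seq c d => c.time + d.time.comp (X + c.growth)
  | ite e c d => C e.weight * (X + 1) + c.time + d.time
  -- The composition evaluates the cost of one iteration at a length that is still valid after all
  -- of them.
  | rep _ _ c => (X + 1) * (c.time + 10 * (X + 1)).comp (X + X * c.growth) + 2 * (X + 1)
  | size _ _ => 20 * (X + 1) * (X + 1)

end Cmd

theorem eval_natPolynomial_mono (p : Polynomial ℕ) {a b : ℕ} (h : a ≤ b) :
    p.eval a ≤ p.eval b := by
  simp only [Polynomial.eval_eq_sum_range]
  gcongr

/-- The loop that computes the length of a number. -/
theorem run_size_loop {x y : ℕ} (hxy : x ≠ y) (W : ℕ) (k : ℕ) (s : Store)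
    (hk : (s.var y).size = k) (hx : s.var x + k ≤ W) (hs : k ≤ W) :
    ∃ t, Run (.loop (.var y) (.seq (.assign y (.op .div (.var y) (.const 2)))
        (.assign x (.op .add (.var x) (.const 1))))) s t
        ((s.setVar x (s.var x + k)).setVar y 0) ∧ t ≤ k * (15 * (W + 1)) + (W + 1) := by
  induction k generalizing s with
  | zero =>
    have h0 : s.var y = 0 := Nat.size_eq_zero.1 hk
    have hst : (s.setVar x (s.var x + 0)).setVar y 0 = s := by
      refine Store.ext (fun z => ?_) rfl
      simp only [Store.setVar_var]
      split_ifs with h1 h2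
      · rw [h1, h0]
      · rw [h2]; rfl
      · rfl
    rw [hst]
    exact ⟨_, Run.loop_done h0, by simp [Expr.cost, h0]⟩
  | succ k ih =>
    have h0 : s.var y ≠ 0 := by intro h; simp [h] at hk
    have hk2 : (s.var y / 2).size = k := by have := size_div_two h0; omega
    set s1 := s.setVar y (s.var y / 2)
    set s2 := s1.setVar x (s.var x + 1)
    have e2y : s2.var y = s.var y / 2 := by simp [s2, s1, hxy.symm]
    have e2x : s2.var x = s.var x + 1 := by simp [s2]
    obtain ⟨t, ht, hle⟩ := ih s2 (by rw [e2y, hk2]) (by omega) (by omega)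
    have r1 := Run.assign s y (.op .div (.var y) (.const 2))
    have r2 := Run.assign s1 x (.op .add (.var x) (.const 1))
    have e1x : s1.var x = s.var x := by simp [s1, hxy]
    have v1 : (Expr.op .div (.var y) (.const 2)).eval s = s.var y / 2 := rfl
    have v2 : (Expr.op .add (.var x) (.const 1)).eval s1 = s.var x + 1 := by
      simp [Expr.eval, BinOp.apply, e1x]
    rw [v1] at r1
    rw [v2] at r2
    have r := Run.loop_step (e := .var y) h0 (r1.seq r2) ht
    have hst : (s.setVar x (s.var x + (k + 1))).setVar y 0 =
        (s2.setVar x (s2.var x + k)).setVar y 0 := by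
      refine Store.ext (fun z => ?_) rfl
      simp only [Store.setVar_var, s2, s1]
      split_ifs <;> first | rfl | omega
    rw [hst]
    refine ⟨_, r, ?_⟩
    · have b1 : (s.var x).size ≤ W := (size_self_le _).trans (by omega)
      have b2 : (s.var x + 1).size ≤ W := (size_self_le _).trans (by omega)
      have b4 : Nat.size 2 = 2 := rfl
      have b5 : Nat.size 1 = 1 := rfl
      simp only [Expr.cost, Expr.eval, e1x, hk, hk2, b4, b5]
      rw [add_mul k 1, one_mul]
      omega

/-- A well-formed command computes its effect in polynomial time. -/
theorem Cmd.run_compile (c : Cmd) (hwf : c.wf = true) (N W : ℕ) (s : Store)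
    (hb : ∀ y ∈ c.bounds, s.var y ≤ N) (hs : s.Small W) :
    ∃ t, Run c.compile s t (c.denote s) ∧ t ≤ c.time.eval (N + W) ∧
      (c.denote s).Small (W + c.growth.eval N) := by
  induction c generalizing s W with
  | skip => exact ⟨1, .skip s, by simp [time], by simpa [denote, growth] using hs⟩
  | assign x e =>
    refine ⟨_, .assign s x e, ?_, ?_⟩
    · have h1 := e.cost_le hs
      have h2 := e.size_eval_le hs
      simp only [time, Polynomial.eval_mul, Polynomial.eval_C, Polynomial.eval_add,
        Polynomial.eval_X, Polynomial.eval_one]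
      have : (e.weight + e.deg + 1) * (W + 1) ≤ (e.weight + e.deg + 1) * (N + W + 1) := by
        gcongr; omega
      simp only [add_mul] at this ⊢
      omega
    · simp only [denote, growth, Polynomial.eval_C]
      exact (hs.mono (by omega)).setVar x (e.size_eval_le_of_mild hs hwf)
  | store a i e =>
    refine ⟨_, .store s a i e, ?_, ?_⟩
    · have h1 := e.cost_le hs
      have h2 := e.size_eval_le hs
      have h3 := i.cost_le hs
      have h4 := i.size_eval_le hs
      simp only [time, Polynomial.eval_mul, Polynomial.eval_C, Polynomial.eval_add,
        Polynomial.eval_X, Polynomial.eval_one]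
      have : (i.weight + e.weight + i.deg + e.deg + 1) * (W + 1) ≤
          (i.weight + e.weight + i.deg + e.deg + 1) * (N + W + 1) := by
        gcongr; omega
      simp only [add_mul] at this ⊢
      omega
    · simp only [denote, growth, Polynomial.eval_C]
      exact (hs.mono (by omega)).setArr a _ (e.size_eval_le_of_mild hs hwf)
  | seq c d hc hd =>
    simp only [wf, Bool.and_eq_true, List.all_eq_true, Bool.not_eq_true', List.contains_eq_mem,
      decide_eq_false_iff_not] at hwf
    obtain ⟨t, ht, hle, hsm⟩ := hc hwf.1.1 W s (fun y hy => hb y (by simp [bounds, hy])) hs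
    obtain ⟨t', ht', hle', hsm'⟩ := hd hwf.1.2 _ (c.denote s) (fun y hy => by
      rw [(c.agree_denote s).1 y (hwf.2 y hy)]
      exact hb y (by simp [bounds, hy])) hsm
    refine ⟨_, ht.seq ht', ?_, ?_⟩
    · simp only [time, Polynomial.eval_add, Polynomial.eval_comp, Polynomial.eval_X]
      refine add_le_add hle (hle'.trans (eval_natPolynomial_mono _ ?_))
      have := eval_natPolynomial_mono c.growth (show N ≤ N + W by omega)
      omega
    · simpa [denote, growth, add_assoc] using hsm'
  | ite e c d hc hd =>
    simp only [wf, Bool.and_eq_true] at hwf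
    have h1 := e.cost_le hs
    have h2 : e.weight * (W + 1) ≤ e.weight * (N + W + 1) := by gcongr; omega
    by_cases he : e.eval s = 0
    · obtain ⟨t, ht, hle, hsm⟩ := hd hwf.2 W s (fun y hy => hb y (by simp [bounds, hy])) hs
      refine ⟨_, (show (ite e c d).denote s = d.denote s by simp [denote, he]) ▸
        Run.ite_false (P := c.compile) he ht, ?_, ?_⟩
      · simp [time]; omega
      · simp only [denote, he, ne_eq, not_true_eq_false, if_false, growth, Polynomial.eval_add]
        exact hsm.mono (by omega)
    · obtain ⟨t, ht, hle, hsm⟩ := hc hwf.1 W s (fun y hy => hb y (by simp [bounds, hy])) hs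
      refine ⟨_, (show (ite e c d).denote s = c.denote s by simp [denote, he]) ▸
        Run.ite_true (Q := d.compile) he ht, ?_, ?_⟩
      · simp [time]; omega
      · simp only [denote, he, ne_eq, not_false_eq_true, if_true, growth, Polynomial.eval_add]
        exact hsm.mono (by omega)
  | rep x y c hc =>
    simp only [wf, Bool.and_eq_true, List.all_eq_true, Bool.not_eq_true', List.contains_eq_mem,
      decide_eq_false_iff_not, List.mem_cons, not_or] at hwf
    obtain ⟨⟨hwf, hxw⟩, hbw⟩ := hwf
    set G := c.growth.eval N
    have hyN : s.var y ≤ N := hb y (by simp [bounds])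
    have key : ∀ V k W' : ℕ, ∀ s' : Store, k ≤ N → s'.var x = k → W' + k * G ≤ V → s'.Small W' →
        (∀ y ∈ c.bounds, s'.var y ≤ N) →
        ∃ t, Run (.loop (.var x) (.seq (.assign x (.op .sub (.var x) (.const 1))) c.compile)) s' t
          (countdown c.denote x k s') ∧
          t ≤ k * (c.time.eval (N + V) + 9 * (V + 1)) + (V + 1) ∧
          (countdown c.denote x k s').Small (W' + k * G) := by
      intro V k
      induction k with
      | zero =>
        intro W' s' _ hx _ hsm _
        refine ⟨_, .loop_done (by simpa [Expr.eval] using hx), ?_, by simpa [countdown] using hsm⟩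
        simp [Expr.cost, hx]
      | succ k ih =>
        intro W' s' hk hx hV hsm hbd
        have hxs : (s'.var x).size ≤ W' := hsm.1 x
        have hks : k.size ≤ W' := (Nat.size_le_size (by omega)).trans hxs
        set s1 := s'.setVar x k
        have hs1 : s1.Small W' := hsm.setVar x hks
        have hb1 : ∀ y ∈ c.bounds, s1.var y ≤ N := fun z hz => by
          simp only [s1, Store.setVar_var, if_neg (hbw z hz).1]; exact hbd z hz
        obtain ⟨t, ht, hle, hsm2⟩ := hc hwf W' s1 hb1 hs1
        have hx2 : (c.denote s1).var x = k := by
          rw [(c.agree_denote s1).1 x hxw]; simp [s1]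
        rw [add_mul, one_mul] at hV
        obtain ⟨t', ht', hle', hsm'⟩ := ih (W' + G) (c.denote s1) (by omega) hx2 (by omega) hsm2
          (fun z hz => by rw [(c.agree_denote s1).1 z (hbw z hz).2]; exact hb1 z hz)
        have r1 := Run.assign s' x (.op .sub (.var x) (.const 1))
        have v1 : (Expr.op .sub (.var x) (.const 1)).eval s' = k := by
          simp [Expr.eval, BinOp.apply, hx]
        rw [v1] at r1
        refine ⟨_, Run.loop_step (e := .var x) (by simp [Expr.eval, hx]) (r1.seq ht) ht', ?_, ?_⟩
        · have := eval_natPolynomial_mono c.time (show N + W' ≤ N + V by omega)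
          have b5 : Nat.size 1 = 1 := rfl
          simp only [Expr.cost, Expr.eval, b5]
          rw [add_mul k 1, one_mul]
          omega
        · simp only [countdown]
          convert hsm' using 1
          ring
    have hys : (s.var y).size ≤ W := hs.1 y
    obtain ⟨t, ht, hle, hsm⟩ := key (W + s.var y * G) (s.var y) W (s.setVar x (s.var y)) hyN
      (by simp) le_rfl (hs.setVar x hys) (fun z hz => by
        rw [Store.setVar_var, if_neg (hbw z hz).1]; exact hb z (by simp [bounds, hz]))
    have r1 := Run.assign s x (.var y)
    refine ⟨_, r1.seq ht, ?_, ?_⟩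
    · have hG : G ≤ c.growth.eval (N + W) := eval_natPolynomial_mono _ (by omega)
      have h1 : N + (W + s.var y * G) ≤ N + W + (N + W) * c.growth.eval (N + W) := by
        have : s.var y * G ≤ (N + W) * c.growth.eval (N + W) := Nat.mul_le_mul (by omega) hG
        omega
      have h2 := eval_natPolynomial_mono c.time h1
      simp only [time, Polynomial.eval_add, Polynomial.eval_mul, Polynomial.eval_comp,
        Polynomial.eval_X, Polynomial.eval_one, Polynomial.eval_ofNat]
      set Z := N + W + (N + W) * c.growth.eval (N + W)
      set F := c.time.eval Z
      have h3 : s.var y * (c.time.eval (N + (W + s.var y * G)) + 9 * (W + s.var y * G + 1)) ≤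
          (N + W) * (F + 10 * (Z + 1)) := Nat.mul_le_mul (by omega) (by omega)
      simp only [Expr.cost, Expr.eval]
      rw [add_mul (N + W) 1, one_mul]
      omega
    · refine hsm.mono ?_
      simp only [growth, Polynomial.eval_mul, Polynomial.eval_X]
      exact Nat.add_le_add_left (Nat.mul_le_mul_right _ hyN) _
  | size x y =>
    have hxy : x ≠ y := by simpa [wf] using hwf
    have hys : (s.var y).size ≤ W := hs.1 y
    have r1 := Run.assign s x (.const 0)
    obtain ⟨t, ht, hle⟩ := run_size_loop hxy W (s.var y).size (s.setVar x 0)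
      (by simp [hxy.symm]) (by simpa using hys) hys
    have hst : ((s.setVar x 0).setVar x ((s.setVar x 0).var x + (s.var y).size)).setVar y 0 =
        (size x y).denote s := by
      refine Store.ext (fun z => ?_) rfl
      simp only [denote, Store.setVar_var]
      split_ifs <;> simp
    rw [hst] at ht
    refine ⟨_, r1.seq ht, ?_,
      ((hs.setVar x ((size_self_le _).trans hys)).setVar y (by simp)).mono (by omega)⟩
    · simp only [time, Polynomial.eval_mul, Polynomial.eval_add, Polynomial.eval_X,
        Polynomial.eval_one, Polynomial.eval_ofNat, Expr.cost, Expr.eval, Nat.size_zero]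
      have : (s.var y).size * (15 * (W + 1)) ≤ (N + W) * (15 * (N + W + 1)) :=
        Nat.mul_le_mul (by omega) (by omega)
      nlinarith

end RAM

/-! ## An auction with approximately best bids -/

namespace Auction

open Finset

/-- The state of the auction: the owner and the price of each good, and a target for the
spending of each agent. -/
structure State where
  owner : ℕ → ℕ
  price : ℕ → ℕ
  target : ℕ

/-- The goods (among the first `m`) owned by `h`. -/
def State.goods (st : State) (m h : ℕ) : Finset ℕ := (range m).filter fun j => st.owner j = h

/-- The total price of the goods owned by `h`. -/
def State.spend (st : State) (m h : ℕ) : ℕ := ∑ j ∈ st.goods m h, st.price j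

/-- The largest price of a good owned by `h`. -/
def State.top (st : State) (m h : ℕ) : ℕ := (st.goods m h).sup st.price

/-- An increase by a factor of slightly more than `1.001`. -/
def bump (a : ℕ) : ℕ := a + a / 1000 + 1

/-- From 1000 on, the added 1 is at most another thousandth. This is the source of the slack 501/500
and the reason why prices and target are kept at least 1000. -/
theorem bump_le {a : ℕ} (h : 1000 ≤ a) : bump a * 500 ≤ 501 * a := by unfold bump; omega

theorem le_bump (a : ℕ) : 1001 * a ≤ 1000 * bump a := by unfold bump; omega

theorem lt_bump (a : ℕ) : a < bump a := by unfold bump; omega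

/-- Every agent reaches the target, and no agent exceeds it without its most expensive good. -/
def State.Final (st : State) (n m : ℕ) : Prop :=
  ∀ i < n, st.target ≤ st.spend m i ∧ st.spend m i ≤ st.target + st.top m i

/-- One step of the auction. An agent below the target takes a good of the best ratio of value and
price, whose price goes up; if there is no such agent, the target goes up, as long as some agent
exceeds it without its most expensive good. -/
inductive Step (n m : ℕ) (v : ℕ → ℕ → ℕ) : State → State → Prop
  | bid {st : State} {i j : ℕ} (hi : i < n) (hj : j < m) (hpoor : st.spend m i < st.target)
      (hbest : ∀ k < m, v i k * st.price j ≤ v i j * st.price k) :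
      Step n m v st ⟨Function.update st.owner j i,
        Function.update st.price j (bump (st.price j)), st.target⟩
  | raise {st : State} {h : ℕ} (hh : h < n) (hrich : ∀ i < n, st.target ≤ st.spend m i)
      (hviol : st.target + st.top m h < st.spend m h) :
      Step n m v st ⟨st.owner, st.price, bump st.target⟩
  | stay {st : State} (hfin : st.Final n m) : Step n m v st st

/-- The invariant of the auction, for valuations between `1` and `U`. -/
structure Inv (n m : ℕ) (v : ℕ → ℕ → ℕ) (U : ℕ) (st : State) : Prop where
  owner_lt : ∀ j < m, st.owner j < n
  price_ge : ∀ j < m, 1000 ≤ st.price j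
  target_ge : 1000 ≤ st.target
  -- The slack pays for the one price increase at the time of the bid; later increases of other
  -- prices only help the owner.
  best : ∀ j < m, ∀ k < m,
    v (st.owner j) k * st.price j * 500 ≤ 501 * (v (st.owner j) j * st.price k)
  -- The second alternative is for agents that have not bid yet: they have only lost goods, and
  -- those they keep have their initial prices.
  fair : ∀ h < n, st.spend m h ≤ st.target + st.top m h ∨
    ∀ j < m, st.owner j = h → st.price j ≤ U
  target_le : st.target ≤ 2 * (m * U)
  price_le : ∀ j < m, st.price j ≤ 4 * (m * U ^ 2)

variable {n m U : ℕ} {v : ℕ → ℕ → ℕ} {st st' : State}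

theorem State.mem_goods {h j : ℕ} : j ∈ st.goods m h ↔ j < m ∧ st.owner j = h := by
  simp [State.goods]

theorem State.price_le_top {h j : ℕ} (hj : j ∈ st.goods m h) : st.price j ≤ st.top m h :=
  Finset.le_sup (f := st.price) hj

/-- If every agent satisfies the upper bound of a final state and some agent is below the target,
then some good costs at most the target. -/
theorem exists_price_le_target (hnm : n ≤ m) (howner : ∀ j < m, st.owner j < n)
    (hfair : ∀ h < n, st.spend m h ≤ st.target + st.top m h) {i : ℕ} (hi : i < n)
    (hpoor : st.spend m i < st.target) : ∃ k < m, st.price k ≤ st.target := by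
  -- If all prices exceeded the target, two goods would put an agent above target plus top price,
  -- and the agent below the target would own nothing. So the `m` goods would have distinct owners
  -- among `n - 1` agents.
  by_contra! hcon
  have hempty : ∀ j < m, st.owner j ≠ i := fun j hj hji => by
    have : st.price j ≤ st.spend m i :=
      Finset.single_le_sum (f := st.price) (fun _ _ => Nat.zero_le _)
        (State.mem_goods.2 ⟨hj, hji⟩)
    have := hcon j hj
    omega
  have hinj : Set.InjOn st.owner (range m : Set ℕ) := by
    intro a ha b hb hab
    by_contra hne
    simp only [coe_range, Set.mem_Iio] at ha hb
    have ha' : a ∈ st.goods m (st.owner a) := State.mem_goods.2 ⟨ha, rfl⟩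
    have hb' : b ∈ st.goods m (st.owner a) := State.mem_goods.2 ⟨hb, hab.symm⟩
    obtain ⟨g, hg, hgt⟩ := Finset.exists_mem_eq_sup _ ⟨a, ha'⟩ st.price
    obtain ⟨c, hc, hcg⟩ : ∃ c ∈ st.goods m (st.owner a), c ≠ g := by
      by_cases h : a = g
      · exact ⟨b, hb', fun h' => hne (h.trans h'.symm)⟩
      · exact ⟨a, ha', h⟩
    have h1 := hfair _ (howner a ha)
    have h2 : st.price g + st.price c ≤ st.spend m (st.owner a) := by
      rw [← Finset.sum_pair (f := st.price) hcg.symm]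
      refine Finset.sum_le_sum_of_subset fun z hz => ?_
      rcases Finset.mem_insert.1 hz with rfl | hz
      · exact hg
      · rwa [Finset.mem_singleton.1 hz]
    have h3 := hcon c (State.mem_goods.1 hc).1
    have h4 : st.top m (st.owner a) = st.price g := hgt
    omega
  have hmaps : Set.MapsTo st.owner (range m : Set ℕ) ((range n).erase i : Finset ℕ) := by
    intro a ha
    simp only [coe_range, Set.mem_Iio] at ha
    rw [Finset.mem_coe, Finset.mem_erase, mem_range]
    exact ⟨hempty a ha, howner a ha⟩
  have := Finset.card_le_card_of_injOn _ hmaps hinj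
  rw [card_range, card_erase_of_mem (mem_range.2 hi), card_range] at this
  omega

/-- As long as an agent bids, some good has a small price. -/
theorem Inv.exists_price_le (hI : Inv n m v U st) (hnm : n ≤ m) {i : ℕ}
    (hi : i < n) (hpoor : st.spend m i < st.target) : ∃ k < m, st.price k ≤ 2 * (m * U) := by
  have hm : 1 ≤ m := by omega
  have hmU : U ≤ m * U := Nat.le_mul_of_pos_left _ hm
  by_cases hf : ∀ h < n, st.spend m h ≤ st.target + st.top m h
  · obtain ⟨k, hk, hle⟩ := exists_price_le_target hnm hI.owner_lt hf hi hpoor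
    exact ⟨k, hk, hle.trans hI.target_le⟩
  -- An agent above the upper bound falls under the second alternative of `fair`, so any of its
  -- goods is cheap.
  · push Not at hf
    obtain ⟨h, hh, hlt⟩ := hf
    have hne : (st.goods m h).Nonempty := by
      by_contra hem
      rw [Finset.not_nonempty_iff_eq_empty] at hem
      simp [State.spend, hem] at hlt
    obtain ⟨k, hk⟩ := hne
    obtain ⟨hk1, hk2⟩ := State.mem_goods.1 hk
    have := (hI.fair h hh).resolve_left (by omega) k hk1 hk2
    exact ⟨k, hk1, by omega⟩

/-- The bidder was below the target before adding `j`, so without `j` it still is. An agent losing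
its top good keeps at most the target; one losing another good keeps its top good and spends less.
-/
theorem fair_bid {i j h : ℕ} (hj : j < m) (hpoor : st.spend m i < st.target)
    (hfair : st.spend m h ≤ st.target + st.top m h) {c : ℕ} (hc : st' =
      ⟨Function.update st.owner j i, Function.update st.price j c, st.target⟩) :
    st'.spend m h ≤ st.target + st'.top m h := by
  have hprice : ∀ s : Finset ℕ, j ∉ s → ∑ k ∈ s, st'.price k = ∑ k ∈ s, st.price k := by
    intro s hs
    refine Finset.sum_congr rfl fun k hk => ?_
    have : k ≠ j := fun h => hs (h ▸ hk)
    simp [hc, this]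
  by_cases hih : i = h
  · subst hih
    have hg : st'.goods m i = insert j ((st.goods m i).erase j) := by
      ext k
      by_cases hkj : k = j
      · simp [State.goods, hc, hkj, hj]
      · simp [State.goods, hc, hkj]
    have h1 : st'.spend m i = st'.price j + ∑ k ∈ (st.goods m i).erase j, st.price k := by
      rw [State.spend, hg, Finset.sum_insert (by simp), hprice _ (by simp)]
    have h2 : ∑ k ∈ (st.goods m i).erase j, st.price k ≤ st.spend m i :=
      Finset.sum_le_sum_of_subset (Finset.erase_subset _ _)
    have h3 : st'.price j ≤ st'.top m i := State.price_le_top (by rw [hg]; simp)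
    omega
  · have hg : st'.goods m h = (st.goods m h).erase j := by
      ext k
      by_cases hkj : k = j
      · simp [State.goods, hc, hkj, hih]
      · simp [State.goods, hc, hkj]
    have h1 : st'.spend m h = ∑ k ∈ (st.goods m h).erase j, st.price k := by
      rw [State.spend, hg, hprice _ (by simp)]
    rcases (st.goods m h).eq_empty_or_nonempty with hem | hne
    · rw [h1, hem]; simp
    obtain ⟨g, hgm, hgt⟩ := Finset.exists_mem_eq_sup _ hne st.price
    have h4 : st.top m h = st.price g := hgt
    by_cases hgj : g = j
    · have h5 : ∑ k ∈ (st.goods m h).erase j, st.price k + st.price j = st.spend m h :=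
        Finset.sum_erase_add _ _ (hgj ▸ hgm)
      rw [hgj] at h4
      omega
    · have h2 : ∑ k ∈ (st.goods m h).erase j, st.price k ≤ st.spend m h :=
        Finset.sum_le_sum_of_subset (Finset.erase_subset _ _)
      have h3 : st'.price g ≤ st'.top m h := State.price_le_top (by rw [hg]; simp [hgj, hgm])
      have h6 : st'.price g = st.price g := by simp [hc, hgj]
      omega

theorem Inv.step (hI : Inv n m v U st) (hnm : n ≤ m)
    (hv : ∀ i < n, ∀ j < m, 1 ≤ v i j ∧ v i j ≤ U) (h : Step n m v st st') :
    Inv n m v U st' := by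
  cases h with
  | stay _ => exact hI
  | raise hh hrich hviol =>
    rename_i h
    refine ⟨hI.owner_lt, hI.price_ge, hI.target_ge.trans (lt_bump _).le, hI.best, fun i hi => ?_,
      ?_, hI.price_le⟩
    · refine (hI.fair i hi).imp (fun hf => ?_) id
      have := lt_bump st.target
      change st.spend m i ≤ bump st.target + st.top m i
      omega
    -- The violating agent still has prices at most `U`, so the old target is below its spending,
    -- which is at most `m * U`; one increase at most doubles it.
    · have hUh := (hI.fair h hh).resolve_left (by omega)
      have h1 : st.spend m h ≤ m * U := by
        refine (Finset.sum_le_card_nsmul _ _ U fun k hk => ?_).trans ?_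
        · obtain ⟨hk1, hk2⟩ := State.mem_goods.1 hk
          exact hUh k hk1 hk2
        · rw [smul_eq_mul]
          exact Nat.mul_le_mul_right _ ((Finset.card_filter_le _ _).trans (card_range m).le)
      have := bump_le hI.target_ge
      change bump st.target ≤ _
      omega
  | bid hi hj hpoor hbest =>
    rename_i i j
    have hlt := lt_bump (st.price j)
    have hble := bump_le (hI.price_ge j hj)
    have hmono : ∀ k, st.price k ≤ Function.update st.price j (bump (st.price j)) k := by
      intro k
      by_cases hk : k = j
      · subst hk; simpa using hlt.le
      · simp [hk]
    refine ⟨fun k hk => ?_, fun k hk => (hI.price_ge k hk).trans (hmono k), hI.target_ge,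
      fun k hk l hl => ?_, fun h hh => ?_, hI.target_le, fun k hk => ?_⟩
    · by_cases hkj : k = j
      · simpa [hkj] using hi
      · simpa [hkj] using hI.owner_lt k hk
    · by_cases hkj : k = j
      · subst hkj
        simp only [Function.update_self]
        calc v i l * bump (st.price k) * 500 = v i l * (bump (st.price k) * 500) := by ring
          _ ≤ v i l * (501 * st.price k) := Nat.mul_le_mul_left _ hble
          _ = 501 * (v i l * st.price k) := by ring
          _ ≤ 501 * (v i k * st.price l) := Nat.mul_le_mul_left _ (hbest l hl)
          _ ≤ _ := Nat.mul_le_mul_left _ (Nat.mul_le_mul_left _ (hmono l))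
      · simp only [Function.update_of_ne hkj]
        exact (hI.best k hk l hl).trans
          (Nat.mul_le_mul_left _ (Nat.mul_le_mul_left _ (hmono l)))
    · by_cases hih : i = h
      · left
        subst hih
        exact fair_bid (st := st) hj hpoor (by omega) rfl
      · refine (hI.fair h hh).imp (fun hf => fair_bid (st := st) hj hpoor hf rfl) fun hf k hk hkh => ?_
        by_cases hkj : k = j
        · simp [hkj, hih] at hkh
        · simp only [Function.update_of_ne hkj] at hkh ⊢
          exact hf k hk hkh
    · by_cases hkj : k = j
      · subst hkj
        simp only [Function.update_self]
        -- Since `k` has a ratio at least as good as the cheap good `l`, its price is at most `U`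
        -- times that of `l`.
        obtain ⟨l, hl, hle⟩ := hI.exists_price_le hnm hi hpoor
        have h1 : st.price k ≤ 2 * (m * U ^ 2) := by
          calc st.price k ≤ v i l * st.price k := Nat.le_mul_of_pos_left _ (hv i hi l hl).1
            _ ≤ v i k * st.price l := hbest l hl
            _ ≤ U * (2 * (m * U)) := Nat.mul_le_mul (hv i hi k hk).2 hle
            _ = 2 * (m * U ^ 2) := by ring
        omega
      · simpa [hkj] using hI.price_le k hk

theorem Step.congr {w : ℕ → ℕ → ℕ} (h : Step n m v st st')
    (hvw : ∀ i < n, ∀ j < m, v i j = w i j) : Step n m w st st' := by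
  cases h with
  | stay hf => exact .stay hf
  | raise hh hrich hviol => exact .raise hh hrich hviol
  | bid hi hj hpoor hbest =>
    refine .bid hi hj hpoor fun k hk => ?_
    rw [← hvw _ hi _ hk, ← hvw _ hi _ hj]
    exact hbest k hk

/-- Final states are fixed, so the program may run a number of rounds computed in advance. -/
theorem Step.eq_of_final (h : Step n m v st st') (hf : st.Final n m) : st' = st := by
  cases h with
  | stay _ => rfl
  | raise hh _ hviol => exact absurd (hf _ hh).2 (by omega)
  | bid hi _ hpoor _ => exact absurd (hf _ hi).1 (by omega)

/-- The product of the target and of all prices. -/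
def State.potential (st : State) (m : ℕ) : ℕ := st.target * ∏ j ∈ range m, st.price j

theorem Step.potential_le (h : Step n m v st st') (hf : ¬ st.Final n m) :
    1001 * st.potential m ≤ 1000 * st'.potential m := by
  cases h with
  | stay h => exact absurd h hf
  | raise _ _ _ =>
    simp only [State.potential, ← mul_assoc]
    exact Nat.mul_le_mul_right _ (le_bump _)
  | bid hi hj hpoor hbest =>
    rename_i i j
    simp only [State.potential]
    rw [Finset.prod_update_of_mem (mem_range.2 hj), ← Finset.mul_prod_erase _ _ (mem_range.2 hj),
      Finset.sdiff_singleton_eq_erase]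
    calc 1001 * (st.target * (st.price j * ∏ x ∈ (range m).erase j, st.price x))
        = st.target * (1001 * st.price j * ∏ x ∈ (range m).erase j, st.price x) := by ring
      _ ≤ st.target * (1000 * bump (st.price j) * ∏ x ∈ (range m).erase j, st.price x) :=
        Nat.mul_le_mul_left _ (Nat.mul_le_mul_right _ (le_bump _))
      _ = _ := by ring

/-- Bernoulli's inequality for `(1 + 1 / a) ^ a`. With `a = 1000`, a thousand steps double the
potential. -/
theorem two_mul_pow_self_le {a b : ℕ} (ha : 0 < a) (hab : a + 1 = b) : 2 * a ^ a ≤ b ^ a := by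
  subst hab
  have ha' : (0 : ℚ) < a := by exact_mod_cast ha
  have h := one_add_mul_le_pow (a := 1 / (a : ℚ)) (by have : 0 < 1 / (a : ℚ) := by positivity
                                                      linarith) a
  rw [mul_one_div_cancel ha'.ne', one_add_one_eq_two] at h
  have h2 : (2 : ℚ) * a ^ a ≤ (1 + 1 / a) ^ a * a ^ a := by gcongr
  rw [← mul_pow, add_mul, one_div_mul_cancel ha'.ne', one_mul] at h2
  exact_mod_cast h2

/-- The invariant holds, and the potential has grown `k` times if no final state was reached. -/
def Progress (n m : ℕ) (v : ℕ → ℕ → ℕ) (U k : ℕ) (st : State) : Prop :=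
  Inv n m v U st ∧ (st.Final n m ∨ 1001 ^ k ≤ 1000 ^ k * st.potential m)

theorem Inv.progress_zero (hI : Inv n m v U st) : Progress n m v U 0 st := by
  refine ⟨hI, Or.inr ?_⟩
  rw [pow_zero, pow_zero, one_mul]
  refine Nat.mul_pos (by have := hI.target_ge; omega) (Finset.prod_pos fun j hj => ?_)
  have := hI.price_ge j (mem_range.1 hj)
  omega

theorem Progress.step {k : ℕ} (h : Progress n m v U k st) (hnm : n ≤ m)
    (hv : ∀ i < n, ∀ j < m, 1 ≤ v i j ∧ v i j ≤ U) (hs : Step n m v st st') :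
    Progress n m v U (k + 1) st' := by
  refine ⟨h.1.step hnm hv hs, ?_⟩
  by_cases hf : st.Final n m
  · exact Or.inl (by rwa [hs.eq_of_final hf])
  · right
    calc 1001 ^ (k + 1) = 1001 * 1001 ^ k := pow_succ' _ _
      _ ≤ 1001 * (1000 ^ k * st.potential m) := Nat.mul_le_mul_left _ (h.2.resolve_left hf)
      _ = 1000 ^ k * (1001 * st.potential m) := by ring
      _ ≤ 1000 ^ k * (1000 * st'.potential m) := Nat.mul_le_mul_left _ (hs.potential_le hf)
      _ = _ := by ring

/-- The auction reaches a final state after polynomially many steps. -/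
theorem Progress.final {r : ℕ} (h : Progress n m v U (1000 * r) st)
    (hr : 2 * (m * U) * (4 * (m * U ^ 2)) ^ m < 2 ^ r) : st.Final n m := by
  refine h.2.resolve_right fun h3 => ?_
  have h2 : st.potential m ≤ 2 * (m * U) * (4 * (m * U ^ 2)) ^ m := by
    refine Nat.mul_le_mul h.1.target_le ?_
    refine (Finset.prod_le_pow_card _ _ _ fun j hj => h.1.price_le j (mem_range.1 hj)).trans ?_
    rw [card_range]
  have h4 : 2 ^ r * (1000 ^ 1000) ^ r ≤ (1001 ^ 1000) ^ r := by
    rw [← mul_pow]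
    exact Nat.pow_le_pow_left (two_mul_pow_self_le (by omega) (by omega)) r
  rw [pow_mul, pow_mul] at h3
  have h5 : 2 ^ r * (1000 ^ 1000) ^ r < 2 ^ r * (1000 ^ 1000) ^ r := by
    calc 2 ^ r * (1000 ^ 1000) ^ r ≤ (1001 ^ 1000) ^ r := h4
      _ ≤ (1000 ^ 1000) ^ r * st.potential m := h3
      _ ≤ (1000 ^ 1000) ^ r * (2 * (m * U) * (4 * (m * U ^ 2)) ^ m) := Nat.mul_le_mul_left _ h2
      _ < (1000 ^ 1000) ^ r * 2 ^ r := Nat.mul_lt_mul_of_pos_left hr (by positivity)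
      _ = _ := mul_comm _ _
  exact lt_irrefl _ h5

end Auction

/-! ## Nash social welfare of final states -/

namespace Auction

open Finset Real

/-! ### A subadditive majorant of the logarithm -/

/-- The tangent of the logarithm at `e` passes through the origin. -/
theorem log_le_div_exp {u : ℝ} (hu : 0 < u) : log u ≤ u / exp 1 := by
  have h := log_le_sub_one_of_pos (div_pos hu (exp_pos 1))
  rw [log_div hu.ne' (exp_pos 1).ne', log_exp] at h
  linarith

/-- The concave majorant of the logarithm that is linear up to `e`. -/
noncomputable def capLog (u : ℝ) : ℝ := if u ≤ exp 1 then u / exp 1 else log u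

theorem log_le_capLog {u : ℝ} (hu : 0 < u) : log u ≤ capLog u := by
  unfold capLog
  split_ifs
  exacts [log_le_div_exp hu, le_rfl]

theorem capLog_le (u : ℝ) : capLog u ≤ u / exp 1 := by
  unfold capLog
  split_ifs with h
  · exact le_rfl
  · exact log_le_div_exp ((exp_pos 1).trans (not_le.1 h))

/-- The quotient `capLog u / u` is constant up to `e`, and beyond `e` it is `log u / u`, which
decreases. Antitonicity of this quotient is what gives subadditivity. -/
theorem capLog_mul_le {u w : ℝ} (hu : 0 < u) (huw : u ≤ w) : capLog w * u ≤ capLog u * w := by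
  have he := exp_pos 1
  unfold capLog
  split_ifs with h1 h2 h2
  · exact le_of_eq (by ring)
  · exact absurd (huw.trans h1) h2
  · have := mul_le_mul_of_nonneg_right (log_le_div_exp (hu.trans_le huw)) hu.le
    exact this.trans (le_of_eq (by ring))
  · have := log_div_self_antitoneOn (not_le.1 h2).le (not_le.1 h1).le huw
    simp only at this
    rwa [div_le_div_iff₀ (hu.trans_le huw) hu] at this

theorem capLog_zero : capLog 0 = 0 := by simp [capLog, (exp_pos 1).le]

theorem capLog_add_le {a b : ℝ} (ha : 0 ≤ a) (hb : 0 ≤ b) :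
    capLog (a + b) ≤ capLog a + capLog b := by
  rcases ha.eq_or_lt with rfl | ha
  · simp [capLog_zero]
  rcases hb.eq_or_lt with rfl | hb
  · simp [capLog_zero]
  have h1 := capLog_mul_le ha (show a ≤ a + b by linarith)
  have h2 := capLog_mul_le hb (show b ≤ a + b by linarith)
  have h3 : capLog (a + b) * (a + b) ≤ (capLog a + capLog b) * (a + b) := by linarith
  exact le_of_mul_le_mul_right h3 (by linarith)

theorem capLog_sum_le {ι : Type*} (s : Finset ι) (f : ι → ℝ) (hf : ∀ j ∈ s, 0 ≤ f j) :
    capLog (∑ j ∈ s, f j) ≤ ∑ j ∈ s, capLog (f j) := by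
  classical
  induction s using Finset.induction_on with
  | empty => simp [capLog_zero]
  | insert a s ha ih =>
    rw [sum_insert ha, sum_insert ha]
    have h1 := hf a (mem_insert_self a s)
    have h2 : ∀ j ∈ s, 0 ≤ f j := fun j hj => hf j (mem_insert_of_mem hj)
    exact (capLog_add_le h1 (sum_nonneg h2)).trans (by linarith [ih h2])

/-- Here `g` is the top price of a final bundle and `r` the price of the rest, in units of the
target. For `g ≤ e` and `u = g + r` the claim follows from `(u - 1) / e ≤ log u`: up to `e` because
`log u ≥ 1 - 1 / u`, beyond `e` because `log u ≥ 1` and `u ≤ e + 1`. For `g > e` monotonicity of the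
logarithm and `r ≤ 1` suffice. -/
theorem capLog_add_div_le {g r : ℝ} (hr : 0 ≤ r) (hr1 : r ≤ 1) (hgr : 1 ≤ g + r) :
    capLog g + r / exp 1 ≤ 1 / exp 1 + log (g + r) := by
  have he := exp_pos 1
  have hre : r / exp 1 ≤ 1 / exp 1 := by gcongr
  unfold capLog
  split_ifs with h
  · rw [← add_div]
    suffices (g + r - 1) / exp 1 ≤ log (g + r) by rw [sub_div] at this; linarith
    rcases le_total (g + r) (exp 1) with h1 | h1
    · have h2 := one_sub_inv_le_log_of_pos (show 0 < g + r by linarith)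
      refine le_trans ?_ h2
      rw [← one_div, one_sub_div (by linarith)]
      gcongr
    · have h2 : 1 ≤ log (g + r) := by
        rw [← log_exp 1]
        exact log_le_log he h1
      refine le_trans ?_ h2
      rw [div_le_one he]
      linarith
  · have : log g ≤ log (g + r) := log_le_log (he.trans (not_le.1 h)) (by linarith)
    linarith

/-- Apart from one good of price `g` the bundle costs at most `T`, so the linear bound `capLog u ≤ u
/ e` loses little on the other goods. -/
theorem capLog_sum_goods_le {s : Finset ℕ} {p : ℕ → ℝ} {T g : ℝ} (hT : 0 < T)
    (hp : ∀ j ∈ s, 0 ≤ p j) (hg : g ∈ p '' s) (hlow : T ≤ ∑ j ∈ s, p j)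
    (hhigh : ∑ j ∈ s, p j ≤ T + g) :
    ∑ j ∈ s, capLog (p j / T) ≤ 1 / exp 1 + log ((∑ j ∈ s, p j) / T) := by
  obtain ⟨k, hk, rfl⟩ := hg
  have hk' : k ∈ s := hk
  rw [← add_sum_erase s p hk'] at hlow hhigh ⊢
  rw [← add_sum_erase s _ hk']
  set R := ∑ j ∈ s.erase k, p j with hR
  have hR0 : 0 ≤ R := sum_nonneg fun j hj => hp j (mem_of_mem_erase hj)
  have h1 : ∑ j ∈ s.erase k, capLog (p j / T) ≤ R / T / exp 1 := by
    rw [hR, sum_div, sum_div]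
    exact sum_le_sum fun j _ => capLog_le _
  have h2 := capLog_add_div_le (g := p k / T) (r := R / T) (div_nonneg hR0 hT.le)
    (by rw [div_le_one hT]; linarith) (by rw [← add_div, le_div_iff₀ hT]; linarith)
  rw [← add_div] at h2
  linarith

/-! ### Comparison of final states with arbitrary allocations -/

/-- If all agents reach the target, but not without their most expensive goods, then the product
of the total prices of the bundles is at least a fraction `e ^ (-n / e)` of the maximum. -/
theorem prod_price_le {n m : ℕ} {x y : ℕ → ℕ} {p : ℕ → ℝ} {T : ℝ} (hT : 0 < T)
    (hp : ∀ j < m, 0 ≤ p j) (hx : ∀ j < m, x j < n) (hy : ∀ j < m, y j < n)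
    (hlow : ∀ i < n, T ≤ ∑ j ∈ range m with x j = i, p j)
    (hhigh : ∀ i < n, ∃ g < m, x g = i ∧ ∑ j ∈ range m with x j = i, p j ≤ T + p g) :
    ∏ i ∈ range n, ∑ j ∈ range m with y j = i, p j ≤
      exp (1 / exp 1) ^ n * ∏ i ∈ range n, ∑ j ∈ range m with x j = i, p j := by
  set sx : ℕ → ℝ := fun i => ∑ j ∈ range m with x j = i, p j with hsx
  set sy : ℕ → ℝ := fun i => ∑ j ∈ range m with y j = i, p j with hsy
  have hp' : ∀ (z : ℕ → ℕ) i, ∀ j ∈ (range m).filter (fun j => z j = i), 0 ≤ p j :=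
    fun z i j hj => hp j (mem_range.1 (mem_filter.1 hj).1)
  have hsx0 : ∀ i ∈ range n, 0 < sx i := fun i hi => hT.trans_le (hlow i (mem_range.1 hi))
  have hsy0 : ∀ i, 0 ≤ sy i := fun i => sum_nonneg (hp' y i)
  have hR : 0 < exp (1 / exp 1) ^ n * ∏ i ∈ range n, sx i :=
    mul_pos (pow_pos (exp_pos _) _) (prod_pos hsx0)
  by_cases h0 : ∃ i ∈ range n, sy i = 0
  · obtain ⟨i, hi, h⟩ := h0
    rw [prod_eq_zero hi h]
    exact hR.le
  push Not at h0
  have hsy1 : ∀ i ∈ range n, 0 < sy i := fun i hi => lt_of_le_of_ne (hsy0 i) (h0 i hi).symm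
  rw [← log_le_log_iff (prod_pos hsy1) hR, log_mul (pow_pos (exp_pos _) _).ne'
    (prod_pos hsx0).ne', log_pow, log_exp, log_prod (fun i hi => (hsy1 i hi).ne'),
    log_prod (fun i hi => (hsx0 i hi).ne')]
  -- The total of `capLog` over all goods is the same for every allocation; `y` is compared with `x`
  -- through it.
  have hfib : ∀ z : ℕ → ℕ, (∀ j < m, z j < n) → ∑ i ∈ range n, ∑ j ∈ range m with z j = i,
      capLog (p j / T) = ∑ j ∈ range m, capLog (p j / T) := fun z hz =>
    sum_fiberwise_of_maps_to (fun j hj => mem_range.2 (hz j (mem_range.1 hj))) _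
  have h1 : ∀ i ∈ range n, log (sy i) - log T ≤ ∑ j ∈ range m with y j = i, capLog (p j / T) := by
    intro i hi
    rw [← log_div (hsy1 i hi).ne' hT.ne']
    refine (log_le_capLog (div_pos (hsy1 i hi) hT)).trans ?_
    rw [hsy, sum_div]
    exact capLog_sum_le _ _ fun j hj => div_nonneg (hp' y i j hj) hT.le
  have h2 : ∀ i ∈ range n, ∑ j ∈ range m with x j = i, capLog (p j / T) ≤
      1 / exp 1 + (log (sx i) - log T) := by
    intro i hi
    obtain ⟨g, hg, hgi, hle⟩ := hhigh i (mem_range.1 hi)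
    rw [← log_div (hsx0 i hi).ne' hT.ne']
    exact capLog_sum_goods_le hT (hp' x i) ⟨g, by simp [hg, hgi], rfl⟩ (hlow i (mem_range.1 hi))
      hle
  have h3 := (sum_le_sum h1).trans ((hfib y hy).trans (hfib x hx).symm).le
  have h4 := h3.trans (sum_le_sum h2)
  simp only [sum_add_distrib, sum_sub_distrib, sum_const, card_range, nsmul_eq_mul] at h4
  linarith

/-- A final state with approximately best bids has approximately maximal Nash social welfare. -/
theorem prod_value_le {n m U : ℕ} {v : ℕ → ℕ → ℕ} {st : State} (hI : Inv n m v U st)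
    (hF : st.Final n m) {y : ℕ → ℕ} (hy : ∀ j < m, y j < n) :
    (∏ i ∈ range n, ∑ j ∈ range m with y j = i, (v i j : ℝ)) ≤
      (1.002 * exp (1 / exp 1)) ^ n *
        ∏ i ∈ range n, ∑ j ∈ range m with st.owner j = i, (v i j : ℝ) := by
  rcases Nat.eq_zero_or_pos n with rfl | hn
  · simp
  have hT : (0 : ℝ) < st.target := by
    have := hI.target_ge
    exact_mod_cast (by omega : 0 < st.target)
  have hpos : ∀ j < m, (0 : ℝ) < st.price j := fun j hj => by
    have := hI.price_ge j hj
    exact_mod_cast (by omega : 0 < st.price j)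
  have hne : ∀ i < n, (st.goods m i).Nonempty := fun i hi => by
    by_contra hem
    rw [Finset.not_nonempty_iff_eq_empty] at hem
    have h1 := (hF i hi).1
    have h2 := hI.target_ge
    simp [State.spend, hem] at h1
    omega
  have hm : (range m).Nonempty := (hne 0 hn).mono (filter_subset _ _)
  have hspend : ∀ i, ((st.spend m i : ℕ) : ℝ) =
      ∑ j ∈ range m with st.owner j = i, (st.price j : ℝ) := fun i => by
    simp [State.spend, State.goods]
  have key := prod_price_le (p := fun j => (st.price j : ℝ)) hT (fun j hj => (hpos j hj).le)
    hI.owner_lt hy (fun i hi => by rw [← hspend]; exact_mod_cast (hF i hi).1) (fun i hi => by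
      obtain ⟨g, hg, hgt⟩ := Finset.exists_mem_eq_sup _ (hne i hi) st.price
      obtain ⟨hg1, hg2⟩ := State.mem_goods.1 hg
      refine ⟨g, hg1, hg2, ?_⟩
      have h1 := (hF i hi).2
      rw [State.top, hgt] at h1
      rw [← hspend]
      exact_mod_cast h1)
  -- `c` is the best ratio of agent `i`. Scaled by it, prices dominate the values of all goods, and
  -- exceed them by at most the factor 1.002 on the agent's own bundle. The product of these factors
  -- occurs on both sides of the price comparison.
  have hc : ∀ i, ∃ c : ℝ, 0 ≤ c ∧ (∀ j < m, (v i j : ℝ) ≤ c * st.price j) ∧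
      ∀ j < m, st.owner j = i → c * st.price j ≤ 1.002 * v i j := by
    intro i
    obtain ⟨k, hk, hmax⟩ := exists_max_image (range m)
      (fun j => (v i j : ℝ) / st.price j) hm
    have hk' := hpos k (mem_range.1 hk)
    refine ⟨v i k / st.price k, by positivity, fun j hj => ?_, fun j hj hji => ?_⟩
    · exact (div_le_iff₀ (hpos j hj)).1 (hmax j (mem_range.2 hj))
    · have h1 := hI.best j hj k (mem_range.1 hk)
      rw [hji] at h1
      have h2 : (v i k : ℝ) * st.price j * 500 ≤ 501 * (v i j * st.price k) := by
        exact_mod_cast h1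
      rw [div_mul_eq_mul_div, div_le_iff₀ hk']
      linarith
  choose c hc0 hc1 hc2 using hc
  have hprod : (∏ i ∈ range n, c i) * ∏ i ∈ range n, ∑ j ∈ range m with st.owner j = i,
      (st.price j : ℝ) ≤ 1.002 ^ n * ∏ i ∈ range n, ∑ j ∈ range m with st.owner j = i,
      (v i j : ℝ) := by
    rw [← prod_mul_distrib]
    have : (1.002 : ℝ) ^ n = ∏ i ∈ range n, 1.002 := by simp
    rw [this, ← prod_mul_distrib]
    refine prod_le_prod (fun i _ => mul_nonneg (hc0 i) (sum_nonneg fun j _ => Nat.cast_nonneg _))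
      fun i _ => ?_
    rw [mul_sum, mul_sum]
    refine sum_le_sum fun j hj => ?_
    obtain ⟨hj1, hj2⟩ := mem_filter.1 hj
    exact hc2 i j (mem_range.1 hj1) hj2
  calc (∏ i ∈ range n, ∑ j ∈ range m with y j = i, (v i j : ℝ))
      ≤ ∏ i ∈ range n, (c i * ∑ j ∈ range m with y j = i, (st.price j : ℝ)) := by
        refine prod_le_prod (fun i _ => sum_nonneg fun j _ => Nat.cast_nonneg _) fun i _ => ?_
        rw [mul_sum]
        exact sum_le_sum fun j hj => hc1 i j (mem_range.1 (mem_filter.1 hj).1)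
    _ = (∏ i ∈ range n, c i) * ∏ i ∈ range n, ∑ j ∈ range m with y j = i, (st.price j : ℝ) :=
        prod_mul_distrib
    _ ≤ (∏ i ∈ range n, c i) * (exp (1 / exp 1) ^ n *
          ∏ i ∈ range n, ∑ j ∈ range m with st.owner j = i, (st.price j : ℝ)) :=
        mul_le_mul_of_nonneg_left key (prod_nonneg fun i _ => hc0 i)
    _ = exp (1 / exp 1) ^ n * ((∏ i ∈ range n, c i) *
          ∏ i ∈ range n, ∑ j ∈ range m with st.owner j = i, (st.price j : ℝ)) := by ring
    _ ≤ exp (1 / exp 1) ^ n * (1.002 ^ n *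
          ∏ i ∈ range n, ∑ j ∈ range m with st.owner j = i, (v i j : ℝ)) :=
        mul_le_mul_of_nonneg_left hprod (pow_pos (exp_pos _) _).le
    _ = _ := by rw [mul_pow]; ring

/-- The true value is about 1.44467; eight terms of the exponential series suffice. -/
theorem exp_one_div_exp_one_le : exp (1 / exp 1) ≤ 1.4447 := by
  have h1 : 1 / exp 1 ≤ 0.367880 := by
    rw [div_le_iff₀ (exp_pos 1)]
    have := exp_one_gt_d9
    linarith
  refine (exp_le_exp.2 h1).trans ?_
  have := exp_bound' (x := 0.367880) (by norm_num) (by norm_num) (n := 8) (by norm_num)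
  refine this.trans ?_
  norm_num [sum_range_succ, Nat.factorial]

/-- Adding a constant to large multiples of the valuations changes the Nash social welfare of good
allocations very little. -/
theorem prod_value_le_of_perturbed {n m K V : ℕ} {v : ℕ → ℕ → ℕ} {x y : ℕ → ℕ} (hn : 0 < n)
    (hV : ∀ i < n, ∑ j ∈ range m, v i j ≤ V) (hK : (2 * (V + 1000 * m)) ^ n < K)
    (hKm : 1000000 * m ≤ K)
    (h : (∏ i ∈ range n, ∑ j ∈ range m with y j = i, ((K * v i j + 1000 : ℕ) : ℝ)) ≤
      (1.002 * exp (1 / exp 1)) ^ n *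
        ∏ i ∈ range n, ∑ j ∈ range m with x j = i, ((K * v i j + 1000 : ℕ) : ℝ)) :
    (∏ i ∈ range n, ∑ j ∈ range m with y j = i, (v i j : ℝ)) ≤
      1.45 ^ n * ∏ i ∈ range n, ∑ j ∈ range m with x j = i, (v i j : ℝ) := by
  set vx : ℕ → ℕ := fun i => ∑ j ∈ range m with x j = i, v i j with hvx
  set vy : ℕ → ℕ := fun i => ∑ j ∈ range m with y j = i, v i j with hvy
  have hcast : ∀ z : ℕ → ℕ, (∏ i ∈ range n, ∑ j ∈ range m with z j = i, (v i j : ℝ)) =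
      ((∏ i ∈ range n, ∑ j ∈ range m with z j = i, v i j : ℕ) : ℝ) := fun z => by push_cast; rfl
  rw [hcast, hcast]
  change ((∏ i ∈ range n, vy i : ℕ) : ℝ) ≤ 1.45 ^ n * ((∏ i ∈ range n, vx i : ℕ) : ℝ)
  -- A nonzero product of integers is at least 1, so the perturbed product of `y` is at least `K ^
  -- n`.
  rcases Nat.eq_zero_or_pos (∏ i ∈ range n, vy i) with h0 | hpos
  · rw [h0, Nat.cast_zero]; positivity
  have hK0 : 0 < K := by omega
  have hlow : K ^ n * ∏ i ∈ range n, vy i ≤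
      ∏ i ∈ range n, ∑ j ∈ range m with y j = i, (K * v i j + 1000) := by
    have : K ^ n = ∏ i ∈ range n, K := by simp
    rw [this, ← prod_mul_distrib]
    refine prod_le_prod' fun i _ => ?_
    rw [hvy, mul_sum]
    exact sum_le_sum fun j _ => by omega
  have hup : ∀ i, ∑ j ∈ range m with x j = i, (K * v i j + 1000) ≤ K * vx i + 1000 * m := by
    intro i
    rw [sum_add_distrib, ← mul_sum, sum_const, smul_eq_mul, mul_comm _ 1000]
    have := (card_filter_le (range m) fun j => x j = i).trans (card_range m).le
    exact Nat.add_le_add_left (Nat.mul_le_mul_left 1000 this) _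
  have hrho : (1.002 * exp (1 / exp 1)) ≤ 1.4476 := by
    have := exp_one_div_exp_one_le
    linarith
  have hrho0 : (0 : ℝ) ≤ 1.002 * exp (1 / exp 1) := by positivity
  have h' : ((K ^ n * ∏ i ∈ range n, vy i : ℕ) : ℝ) ≤ 1.4476 ^ n *
      ((∏ i ∈ range n, (K * vx i + 1000 * m) : ℕ) : ℝ) := by
    calc ((K ^ n * ∏ i ∈ range n, vy i : ℕ) : ℝ)
        ≤ ((∏ i ∈ range n, ∑ j ∈ range m with y j = i, (K * v i j + 1000) : ℕ) : ℝ) := by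
          exact_mod_cast hlow
      _ ≤ (1.002 * exp (1 / exp 1)) ^ n * ((∏ i ∈ range n, ∑ j ∈ range m with x j = i,
          (K * v i j + 1000) : ℕ) : ℝ) := by push_cast at h ⊢; exact h
      _ ≤ _ := by
          refine mul_le_mul (pow_le_pow_left₀ hrho0 hrho n) ?_ (Nat.cast_nonneg _) (by positivity)
          exact_mod_cast prod_le_prod' fun i _ => hup i
  -- A bundle of original value zero has perturbed value at most `1000 * m`, without a factor `K`.
  -- The product for `x` would then be of order `K ^ (n - 1)`, too small because `K` exceeds `(2 *
  -- (V + 1000 * m)) ^ n`; the 2 covers the ratio 1.4476.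
  have hvx1 : ∀ i ∈ range n, 1 ≤ vx i := by
    by_contra! hcon
    obtain ⟨i, hi, hlt⟩ := hcon
    have hi0 : vx i = 0 := by omega
    have hb : ∀ l ∈ (range n).erase i, K * vx l + 1000 * m ≤ K * (V + 1000 * m) := by
      intro l hl
      have h1 : vx l ≤ V := (sum_le_sum_of_subset (filter_subset _ _)).trans
        (hV l (mem_range.1 (mem_of_mem_erase hl)))
      have h2 : K * vx l ≤ K * V := Nat.mul_le_mul_left _ h1
      have h3 : 1000 * m ≤ K * (1000 * m) := Nat.le_mul_of_pos_left _ hK0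
      rw [mul_add]; omega
    have hprod : ∏ l ∈ range n, (K * vx l + 1000 * m) ≤
        (V + 1000 * m) * (K * (V + 1000 * m)) ^ (n - 1) := by
      rw [← mul_prod_erase _ _ hi, hi0, mul_zero, zero_add]
      refine Nat.mul_le_mul (by omega) ((prod_le_pow_card _ _ _ hb).trans ?_)
      rw [card_erase_of_mem hi, card_range]
    have h1 : (K : ℝ) ^ n ≤ 2 ^ n * ((V + 1000 * m : ℕ) * (K * (V + 1000 * m : ℕ)) ^ (n - 1)) := by
      calc (K : ℝ) ^ n ≤ ((K ^ n * ∏ i ∈ range n, vy i : ℕ) : ℝ) := by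
            exact_mod_cast Nat.le_mul_of_pos_right _ hpos
        _ ≤ _ := h'
        _ ≤ 2 ^ n * (((V + 1000 * m) * (K * (V + 1000 * m)) ^ (n - 1) : ℕ) : ℝ) := by
            refine mul_le_mul (pow_le_pow_left₀ (by norm_num) (by norm_num) n) ?_
              (Nat.cast_nonneg _) (by positivity)
            exact_mod_cast hprod
        _ = _ := by push_cast; ring
    have h2 : K ^ n ≤ 2 ^ n * ((V + 1000 * m) * (K * (V + 1000 * m)) ^ (n - 1)) := by
      exact_mod_cast h1
    obtain ⟨k, rfl⟩ : ∃ k, n = k + 1 := ⟨n - 1, by omega⟩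
    rw [Nat.add_sub_cancel] at h2
    have h3 : 2 ^ (k + 1) * ((V + 1000 * m) * (K * (V + 1000 * m)) ^ k) =
        (2 * (V + 1000 * m)) ^ (k + 1) * K ^ k := by
      generalize V + 1000 * m = A
      ring
    have h4 : (2 * (V + 1000 * m)) ^ (k + 1) * K ^ k < K * K ^ k :=
      Nat.mul_lt_mul_of_pos_right hK (pow_pos hK0 k)
    rw [h3] at h2
    rw [pow_succ'] at h2
    omega
  -- As `vx i` is at least 1 and `K` at least `1000000 * m`, the perturbation adds at most a
  -- thousandth.
  have hfinal : ((∏ i ∈ range n, (K * vx i + 1000 * m) : ℕ) : ℝ) ≤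
      (K * 1.001) ^ n * ((∏ i ∈ range n, vx i : ℕ) : ℝ) := by
    have : ((K : ℝ) * 1.001) ^ n = ∏ i ∈ range n, ((K : ℝ) * 1.001) := by simp
    rw [this, Nat.cast_prod, Nat.cast_prod, ← prod_mul_distrib]
    refine prod_le_prod (fun i _ => Nat.cast_nonneg _) fun i hi => ?_
    have h1 : (1 : ℝ) ≤ vx i := by exact_mod_cast hvx1 i hi
    have h2 : (1000000 : ℝ) * m ≤ K := by exact_mod_cast hKm
    have h3 : (0 : ℝ) ≤ K := Nat.cast_nonneg _
    push_cast
    nlinarith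
  have hKR : (0 : ℝ) < (K : ℝ) ^ n := pow_pos (by exact_mod_cast hK0) n
  refine le_of_mul_le_mul_left ?_ hKR
  calc (K : ℝ) ^ n * ((∏ i ∈ range n, vy i : ℕ) : ℝ)
      = ((K ^ n * ∏ i ∈ range n, vy i : ℕ) : ℝ) := by push_cast; ring
    _ ≤ 1.4476 ^ n * ((K * 1.001) ^ n * ((∏ i ∈ range n, vx i : ℕ) : ℝ)) :=
        h'.trans (mul_le_mul_of_nonneg_left hfinal (by positivity))
    _ = (K : ℝ) ^ n * ((1.4476 * 1.001) ^ n * ((∏ i ∈ range n, vx i : ℕ) : ℝ)) := by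
        rw [mul_pow, mul_pow]; ring
    _ ≤ (K : ℝ) ^ n * (1.45 ^ n * ((∏ i ∈ range n, vx i : ℕ) : ℝ)) := by
        refine mul_le_mul_of_nonneg_left (mul_le_mul_of_nonneg_right ?_ (Nat.cast_nonneg _)) hKR.le
        exact pow_le_pow_left₀ (by norm_num) (by norm_num) n

end Auction

/-! ## The auction as a program -/

namespace Auction

open RAM RAM.Cmd Finset

/-- The entry of a matrix with rows of length `m` (variable `1`) at the indices held by two
variables. -/
def entry (a i j : ℕ) : Expr := .get a (.op .add (.op .mul (.var i) (.var 1)) (.var j))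

/-- Variable `4` becomes an upper bound for all numbers in the input. -/
def totalCmd : Cmd :=
  -- Counting entries twice and adding a million each time makes `2 ^ B`, for the length `B` of the
  -- total, large enough for every later estimate: it exceeds `2 * (V + 1000 * m)`, `1000000 * m`
  -- and each entry plus 1000.
  rep 2 0 (rep 3 1 (assign 4 (.op .add (.var 4)
    (.op .add (.op .add (entry 0 2 3) (entry 0 2 3)) (.const 1000000)))))

/-- Variable `9` is multiplied by the power of two given by variables `0` and `5`. -/
def shiftCmd : Cmd := rep 7 0 (rep 8 5 (assign 9 (.op .add (.var 9) (.var 9))))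

/-- Array `2` receives the perturbed valuations. -/
def scaleCmd : Cmd :=
  rep 2 0 (rep 3 1 (seq (assign 9 (entry 0 2 3)) (seq shiftCmd
    (store 2 (.op .add (.op .mul (.var 2) (.var 1)) (.var 3))
      (.op .add (.var 9) (.const 1000))))))

/-- Variable `6` becomes the number of rounds. -/
def countCmd : Cmd :=
  rep 2 0 (rep 3 1 (rep 7 5 (assign 6 (.op .add (.var 6) (.const 8000)))))

/-- The highest value of the good in variable `3` and an agent of that value. -/
def highestCmd : Cmd :=
  seq (assign 10 (.const 0)) (seq (assign 11 (.const 0))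
    (rep 2 0 (ite (.op .lt (.var 10) (entry 2 2 3))
      (seq (assign 10 (entry 2 2 3)) (assign 11 (.var 2))) skip)))

/-- The initial state: array `1` holds the owners, array `3` the prices, variable `12` the
target. -/
def initCmd : Cmd :=
  seq (rep 3 1 (seq highestCmd (seq (store 1 (.var 3) (.var 11)) (store 3 (.var 3) (.var 10)))))
    (assign 12 (.const 1000))

/-- The spending of the agent in variable `2` and its highest price. -/
def scanCmd : Cmd :=
  seq (assign 10 (.const 0)) (seq (assign 11 (.const 0))
    (rep 3 1 (ite (.op .eq (.get 1 (.var 3)) (.var 2))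
      (seq (assign 10 (.op .add (.var 10) (.get 3 (.var 3))))
        (ite (.op .lt (.var 11) (.get 3 (.var 3))) (assign 11 (.get 3 (.var 3))) skip)) skip)))

/-- Variable `13` becomes the successor of an agent below the target, if there is one, and variable
`14` tells whether some agent has too much. -/
def checkCmd : Cmd :=
  seq (assign 13 (.const 0)) (seq (assign 14 (.const 0))
    (rep 2 0 (seq scanCmd
      (seq (ite (.op .lt (.var 10) (.var 12)) (assign 13 (.op .add (.var 2) (.const 1))) skip)
        (ite (.op .lt (.op .add (.var 12) (.var 11)) (.var 10)) (assign 14 (.const 1)) skip)))))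

/-- A good of the best ratio of value and price for the agent in variable `2`. -/
def bestCmd : Cmd :=
  seq (assign 15 (.const 0))
    (rep 3 1 (ite (.op .lt (.op .mul (entry 2 2 15) (.get 3 (.var 3)))
      (.op .mul (entry 2 2 3) (.get 3 (.var 15)))) (assign 15 (.var 3)) skip))

/-- The expression for `bump`. -/
def bumpExpr (e : Expr) : Expr :=
  .op .add (.op .add e (.op .div e (.const 1000))) (.const 1)

/-- One step of the auction. -/
def roundCmd : Cmd :=
  seq checkCmd (ite (.var 13)
    (seq (assign 2 (.op .sub (.var 13) (.const 1))) (seq bestCmd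
      (seq (store 1 (.var 15) (.var 2)) (store 3 (.var 15) (bumpExpr (.get 3 (.var 15)))))))
    (ite (.var 14) (assign 12 (bumpExpr (.var 12))) skip))

/-- The auction. -/
def auctionCmd : Cmd := rep 16 6 roundCmd

/-- The state of the auction in the store. -/
def stateOf (s : Store) : State := ⟨s.arr 1, s.arr 3, s.var 12⟩

/-! ### Correctness of the commands -/

/-- Loops count down, so invariants concern the indices from `k` on and each iteration adds one at
the bottom. -/
theorem Ico_eq_insert {k m : ℕ} (h : k < m) : Ico k m = insert k (Ico (k + 1) m) := by
  ext j; simp only [mem_Ico, mem_insert]; omega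

theorem total_spec (s : Store) : (totalCmd.denote s).var 4 = s.var 4 +
    ∑ i ∈ range (s.var 0), ∑ j ∈ range (s.var 1),
      (s.arr 0 (i * s.var 1 + j) + s.arr 0 (i * s.var 1 + j) + 1000000) := by
  rw [range_eq_Ico, range_eq_Ico]
  refine rep_induction (fun k s' => s'.var 4 = s.var 4 + ∑ i ∈ Ico k (s.var 0),
    ∑ j ∈ Ico 0 (s.var 1),
      (s.arr 0 (i * s.var 1 + j) + s.arr 0 (i * s.var 1 + j) + 1000000)) (by simp) ?_
  intro k hk s₁ ha h₁
  have e1 : s₁.var 1 = s.var 1 := ha.1 1 (by decide)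
  have e0 : s₁.arr 0 = s.arr 0 := ha.2 0 (by decide)
  have := rep_induction (x := 3) (y := 1) (s := s₁.setVar 2 k) (c := assign 4 (.op .add (.var 4)
    (.op .add (.op .add (entry 0 2 3) (entry 0 2 3)) (.const 1000000))))
    (fun l s' => s'.var 4 = s₁.var 4 + ∑ j ∈ Ico l (s.var 1),
      (s.arr 0 (k * s.var 1 + j) + s.arr 0 (k * s.var 1 + j) + 1000000)) (by simp [e1]) (by
    intro l hl s₂ hb h₂
    have f1 : s₂.var 1 = s.var 1 := (hb.1 1 (by decide)).trans (by simp [e1])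
    have f2 : s₂.var 2 = k := (hb.1 2 (by decide)).trans (by simp)
    have f0 : s₂.arr 0 = s.arr 0 := (hb.2 0 (by decide)).trans (by simp [e0])
    have hl' : l < s.var 1 := by simpa [e1] using hl
    rw [sum_eq_sum_Ico_succ_bot hl']
    simp [denote, Expr.eval, BinOp.apply, entry, f1, f2, f0, h₂]
    ring)
  rw [sum_eq_sum_Ico_succ_bot hk]
  simp only [denote] at this ⊢
  rw [this, h₁]
  ring

/-- The power is built by doublings, each an addition lengthening the entry by a bounded amount,
since products may not be stored. The product of the current value and the outstanding power of two
is invariant. -/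
theorem shift_spec (s : Store) :
    (shiftCmd.denote s).var 9 = 2 ^ (s.var 0 * s.var 5) * s.var 9 := by
  have := rep_induction (x := 7) (y := 0) (s := s)
    (c := rep 8 5 (assign 9 (.op .add (.var 9) (.var 9))))
    (fun k s' => 2 ^ (k * s.var 5) * s'.var 9 = 2 ^ (s.var 0 * s.var 5) * s.var 9) (by simp) (by
    intro k hk s₁ ha h₁
    have e5 : s₁.var 5 = s.var 5 := ha.1 5 (by decide)
    have := rep_induction (x := 8) (y := 5) (s := s₁.setVar 7 k)
      (c := assign 9 (.op .add (.var 9) (.var 9)))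
      (fun l s' => 2 ^ l * s'.var 9 = 2 ^ s.var 5 * s₁.var 9) (by simp [e5]) (by
      intro l hl s₂ hb h₂
      rw [← h₂]
      simp [denote, Expr.eval, BinOp.apply]
      ring)
    rw [pow_zero, one_mul] at this
    rw [this, ← h₁]
    ring)
  simp only [zero_mul, pow_zero, one_mul] at this
  exact this

theorem scale_spec (s : Store) {i j : ℕ} (hi : i < s.var 0) (hj : j < s.var 1) :
    (scaleCmd.denote s).arr 2 (i * s.var 1 + j) =
      2 ^ (s.var 0 * s.var 5) * s.arr 0 (i * s.var 1 + j) + 1000 := by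
  have := rep_induction (x := 2) (y := 0) (s := s) (c := rep 3 1 (seq (assign 9 (entry 0 2 3))
      (seq shiftCmd (store 2 (.op .add (.op .mul (.var 2) (.var 1)) (.var 3))
      (.op .add (.var 9) (.const 1000))))))
    (fun k s' => ∀ i j, k ≤ i → i < s.var 0 → j < s.var 1 → s'.arr 2 (i * s.var 1 + j) =
      2 ^ (s.var 0 * s.var 5) * s.arr 0 (i * s.var 1 + j) + 1000)
    (fun i j h1 h2 _ => by omega) (by
    intro k hk s₁ ha h₁
    have e0 : s₁.var 0 = s.var 0 := ha.1 0 (by decide)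
    have e1 : s₁.var 1 = s.var 1 := ha.1 1 (by decide)
    have e5 : s₁.var 5 = s.var 5 := ha.1 5 (by decide)
    have ea : s₁.arr 0 = s.arr 0 := ha.2 0 (by decide)
    have := rep_induction (x := 3) (y := 1) (s := s₁.setVar 2 k) (c := seq (assign 9 (entry 0 2 3))
      (seq shiftCmd (store 2 (.op .add (.op .mul (.var 2) (.var 1)) (.var 3))
      (.op .add (.var 9) (.const 1000)))))
      (fun l s' => ∀ i j, k < i ∨ (i = k ∧ l ≤ j) → i < s.var 0 → j < s.var 1 →
        s'.arr 2 (i * s.var 1 + j) =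
        2 ^ (s.var 0 * s.var 5) * s.arr 0 (i * s.var 1 + j) + 1000)
      (by
        intro i j h hi hj
        rcases h with h | ⟨rfl, h⟩
        · exact h₁ i j h hi hj
        · simp [e1] at h; omega) (by
      intro l hl s₂ hb h₂ i j h hi hj
      have f0 : s₂.var 0 = s.var 0 := (hb.1 0 (by decide)).trans (by simp [e0])
      have f1 : s₂.var 1 = s.var 1 := (hb.1 1 (by decide)).trans (by simp [e1])
      have f2 : s₂.var 2 = k := (hb.1 2 (by decide)).trans (by simp)
      have f5 : s₂.var 5 = s.var 5 := (hb.1 5 (by decide)).trans (by simp [e5])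
      have fa : s₂.arr 0 = s.arr 0 := (hb.2 0 (by decide)).trans (by simp [ea])
      set s₃ := (assign 9 (entry 0 2 3)).denote (s₂.setVar 3 l) with hs₃
      have g0 : s₃.var 0 = s.var 0 := by simp [hs₃, denote, f0]
      have g5 : s₃.var 5 = s.var 5 := by simp [hs₃, denote, f5]
      have g9 : s₃.var 9 = s.arr 0 (k * s.var 1 + l) := by
        simp [hs₃, denote, entry, Expr.eval, BinOp.apply, f1, f2, fa]
      have hs := shift_spec s₃
      have k1 : (shiftCmd.denote s₃).var 1 = s.var 1 :=
        ((agree_denote shiftCmd s₃).1 1 (by decide)).trans (by simp [hs₃, denote, f1])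
      have k2 : (shiftCmd.denote s₃).var 2 = k :=
        ((agree_denote shiftCmd s₃).1 2 (by decide)).trans (by simp [hs₃, denote, f2])
      have k3 : (shiftCmd.denote s₃).var 3 = l :=
        ((agree_denote shiftCmd s₃).1 3 (by decide)).trans (by simp [hs₃, denote])
      have ka : (shiftCmd.denote s₃).arr 2 = s₂.arr 2 :=
        ((agree_denote shiftCmd s₃).2 2 (by decide)).trans (by simp [hs₃, denote])
      have hval : (seq (assign 9 (entry 0 2 3)) (seq shiftCmd
          (store 2 (.op .add (.op .mul (.var 2) (.var 1)) (.var 3))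
            (.op .add (.var 9) (.const 1000))))).denote (s₂.setVar 3 l) =
          (shiftCmd.denote s₃).setArr 2 ((shiftCmd.denote s₃).var 2 *
            (shiftCmd.denote s₃).var 1 + (shiftCmd.denote s₃).var 3)
            ((shiftCmd.denote s₃).var 9 + 1000) := rfl
      rw [hval]
      simp only [k1, k2, k3, hs, g0, g5, g9, Store.setArr_arr, if_true, ka]
      by_cases hidx : i * s.var 1 + j = k * s.var 1 + l
      · rw [hidx, Function.update_self]
      · rw [Function.update_of_ne hidx]
        refine h₂ i j ?_ hi hj
        rcases h with h | ⟨rfl, h⟩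
        · exact Or.inl h
        · refine Or.inr ⟨rfl, ?_⟩
          rcases h.eq_or_lt with rfl | h
          · exact absurd rfl hidx
          · exact h)
    intro i j hki hi hj
    refine this i j ?_ hi hj
    rcases hki.eq_or_lt with rfl | h
    exacts [Or.inr ⟨rfl, Nat.zero_le _⟩, Or.inl h])
  exact this i j (Nat.zero_le _) hi hj

theorem count_spec (s : Store) :
    (countCmd.denote s).var 6 = s.var 6 + s.var 0 * (s.var 1 * (s.var 5 * 8000)) := by
  have := rep_induction (x := 2) (y := 0) (s := s)
    (c := rep 3 1 (rep 7 5 (assign 6 (.op .add (.var 6) (.const 8000)))))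
    (fun k s' => s'.var 6 + k * (s.var 1 * (s.var 5 * 8000)) =
      s.var 6 + s.var 0 * (s.var 1 * (s.var 5 * 8000))) (by simp) (by
    intro k hk s₁ ha h₁
    have e1 : s₁.var 1 = s.var 1 := ha.1 1 (by decide)
    have e5 : s₁.var 5 = s.var 5 := ha.1 5 (by decide)
    have := rep_induction (x := 3) (y := 1) (s := s₁.setVar 2 k)
      (c := rep 7 5 (assign 6 (.op .add (.var 6) (.const 8000))))
      (fun l s' => s'.var 6 + l * (s.var 5 * 8000) =
        s₁.var 6 + s.var 1 * (s.var 5 * 8000)) (by simp [e1]) (by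
      intro l hl s₂ hb h₂
      have f5 : s₂.var 5 = s.var 5 := (hb.1 5 (by decide)).trans (by simp [e5])
      have := rep_induction (x := 7) (y := 5) (s := s₂.setVar 3 l)
        (c := assign 6 (.op .add (.var 6) (.const 8000)))
        (fun q s' => s'.var 6 + q * 8000 = s₂.var 6 + s.var 5 * 8000) (by simp [f5]) (by
        intro q hq s₃ hc h₃
        rw [← h₃]
        simp [denote, Expr.eval, BinOp.apply]
        ring)
      rw [zero_mul, add_zero] at this
      rw [this, ← h₂]
      ring)
    rw [zero_mul, add_zero] at this
    rw [this, ← h₁]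
    ring)
  rw [zero_mul, add_zero] at this
  exact this

theorem highest_spec (s : Store) :
    (∀ i < s.var 0, s.arr 2 (i * s.var 1 + s.var 3) ≤ (highestCmd.denote s).var 10) ∧
    ((highestCmd.denote s).var 10 = 0 ∨ ((highestCmd.denote s).var 11 < s.var 0 ∧
      (highestCmd.denote s).var 10 =
        s.arr 2 ((highestCmd.denote s).var 11 * s.var 1 + s.var 3))) := by
  have := rep_induction (x := 2) (y := 0) (s := (s.setVar 10 0).setVar 11 0)
    (c := ite (.op .lt (.var 10) (entry 2 2 3))
      (seq (assign 10 (entry 2 2 3)) (assign 11 (.var 2))) skip)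
    (fun k s' => (∀ i, k ≤ i → i < s.var 0 → s.arr 2 (i * s.var 1 + s.var 3) ≤ s'.var 10) ∧
      (s'.var 10 = 0 ∨ (s'.var 11 < s.var 0 ∧
        s'.var 10 = s.arr 2 (s'.var 11 * s.var 1 + s.var 3))))
    ⟨fun i h1 h2 => by simp at h1; omega, by simp⟩ (by
    intro k hk s₁ ha h₁
    have e1 : s₁.var 1 = s.var 1 := (ha.1 1 (by decide)).trans (by simp)
    have e3 : s₁.var 3 = s.var 3 := (ha.1 3 (by decide)).trans (by simp)
    have ea : s₁.arr 2 = s.arr 2 := ha.2 2 (by decide)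
    have hk' : k < s.var 0 := by simpa using hk
    by_cases hlt : s₁.var 10 < s.arr 2 (k * s.var 1 + s.var 3)
    · simp [denote, Expr.eval, BinOp.apply, entry, e1, e3, ea, hlt, hk']
      intro i hki hi
      rcases hki.eq_or_lt with rfl | h
      · exact le_rfl
      · exact (h₁.1 i h hi).trans hlt.le
    · simp [denote, Expr.eval, BinOp.apply, entry, e1, e3, ea, hlt]
      refine ⟨fun i hki hi => ?_, h₁.2⟩
      rcases hki.eq_or_lt with rfl | h
      · omega
      · exact h₁.1 i h hi)
  exact ⟨fun i hi => this.1 i (Nat.zero_le _) hi, this.2⟩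

/-- The search for the highest value starts from 0; positivity of the valuations ensures that it
ends with a genuine agent. -/
theorem init_spec (s : Store) (h0 : 0 < s.var 0)
    (hpos : ∀ i < s.var 0, ∀ j < s.var 1, 0 < s.arr 2 (i * s.var 1 + j)) :
    (initCmd.denote s).var 12 = 1000 ∧ ∀ j < s.var 1, (initCmd.denote s).arr 1 j < s.var 0 ∧
      (initCmd.denote s).arr 3 j = s.arr 2 ((initCmd.denote s).arr 1 j * s.var 1 + j) ∧
      ∀ i < s.var 0, s.arr 2 (i * s.var 1 + j) ≤ (initCmd.denote s).arr 3 j := by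
  have := rep_induction (x := 3) (y := 1) (s := s)
    (c := seq highestCmd (seq (store 1 (.var 3) (.var 11)) (store 3 (.var 3) (.var 10))))
    (fun k s' => ∀ j, k ≤ j → j < s.var 1 → s'.arr 1 j < s.var 0 ∧
      s'.arr 3 j = s.arr 2 (s'.arr 1 j * s.var 1 + j) ∧
      ∀ i < s.var 0, s.arr 2 (i * s.var 1 + j) ≤ s'.arr 3 j)
    (fun j h1 h2 => by omega) (by
    intro k hk s₁ ha h₁ j hkj hj
    have e0 : s₁.var 0 = s.var 0 := ha.1 0 (by decide)
    have e1 : s₁.var 1 = s.var 1 := ha.1 1 (by decide)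
    have ea : s₁.arr 2 = s.arr 2 := ha.2 2 (by decide)
    have hs := highest_spec (s₁.setVar 3 k)
    have hag := agree_denote highestCmd (s₁.setVar 3 k)
    set s₂ := highestCmd.denote (s₁.setVar 3 k) with hs₂
    have f3 : s₂.var 3 = k := (hag.1 3 (by decide)).trans (by simp)
    have fa : s₂.arr 1 = s₁.arr 1 := hag.2 1 (by decide)
    have fb : s₂.arr 3 = s₁.arr 3 := hag.2 3 (by decide)
    simp [e0, e1, ea] at hs
    simp only [denote, ← hs₂]
    by_cases hjk : j = k
    · subst hjk
      have h1 := hs.1 0 h0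
      have h2 := hpos 0 h0 j hj
      have h3 := hs.2.resolve_left (by omega)
      simp [Expr.eval, f3, h3.1]
      exact ⟨h3.2, hs.1⟩
    · simp [Expr.eval, f3, fa, fb, hjk]
      exact h₁ j (by omega) hj)
  refine ⟨by simp [initCmd, denote, Expr.eval], fun j hj => ?_⟩
  exact this j (Nat.zero_le _) hj

theorem scan_spec (s : Store) :
    (scanCmd.denote s).var 10 = (stateOf s).spend (s.var 1) (s.var 2) ∧
    (scanCmd.denote s).var 11 = (stateOf s).top (s.var 1) (s.var 2) := by
  simp only [State.spend, State.top, State.goods, range_eq_Ico]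
  exact rep_induction (x := 3) (y := 1) (s := (s.setVar 10 0).setVar 11 0)
    (c := ite (.op .eq (.get 1 (.var 3)) (.var 2))
      (seq (assign 10 (.op .add (.var 10) (.get 3 (.var 3))))
        (ite (.op .lt (.var 11) (.get 3 (.var 3))) (assign 11 (.get 3 (.var 3))) skip)) skip)
    (fun k s' => s'.var 10 = ∑ j ∈ Ico k (s.var 1) with s.arr 1 j = s.var 2, s.arr 3 j ∧
      s'.var 11 = ((Ico k (s.var 1)).filter fun j => s.arr 1 j = s.var 2).sup (s.arr 3))
    (by simp) (by
    intro k hk s₁ ha h₁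
    have e2 : s₁.var 2 = s.var 2 := (ha.1 2 (by decide)).trans (by simp)
    have ea : s₁.arr 1 = s.arr 1 := ha.2 1 (by decide)
    have eb : s₁.arr 3 = s.arr 3 := ha.2 3 (by decide)
    have hk' : k < s.var 1 := by simpa using hk
    rw [Ico_eq_insert hk', filter_insert]
    by_cases hown : s.arr 1 k = s.var 2
    · rw [if_pos hown, sum_insert (by simp), sup_insert, ← h₁.1, ← h₁.2]
      by_cases hlt : s₁.var 11 < s.arr 3 k
      · simp [denote, Expr.eval, BinOp.apply, e2, ea, eb, hown, hlt, hlt.le, add_comm]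
      · simp [denote, Expr.eval, BinOp.apply, e2, ea, eb, hown, hlt, add_comm]
        omega
    · rw [if_neg hown, ← h₁.1, ← h₁.2]
      simp [denote, Expr.eval, BinOp.apply, e2, ea, hown])

theorem check_spec (s : Store) :
    ((checkCmd.denote s).var 13 = 0 → ∀ i < s.var 0,
      s.var 12 ≤ (stateOf s).spend (s.var 1) i) ∧
    ((checkCmd.denote s).var 13 ≠ 0 → (checkCmd.denote s).var 13 - 1 < s.var 0 ∧
      (stateOf s).spend (s.var 1) ((checkCmd.denote s).var 13 - 1) < s.var 12) ∧
    ((checkCmd.denote s).var 14 = 0 → ∀ i < s.var 0,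
      (stateOf s).spend (s.var 1) i ≤ s.var 12 + (stateOf s).top (s.var 1) i) ∧
    ((checkCmd.denote s).var 14 ≠ 0 → ∃ i < s.var 0,
      s.var 12 + (stateOf s).top (s.var 1) i < (stateOf s).spend (s.var 1) i) := by
  have := rep_induction (x := 2) (y := 0) (s := (s.setVar 13 0).setVar 14 0)
    (c := seq scanCmd
      (seq (ite (.op .lt (.var 10) (.var 12)) (assign 13 (.op .add (.var 2) (.const 1))) skip)
        (ite (.op .lt (.op .add (.var 12) (.var 11)) (.var 10)) (assign 14 (.const 1)) skip)))
    (fun k s' =>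
      (s'.var 13 = 0 → ∀ i, k ≤ i → i < s.var 0 → s.var 12 ≤ (stateOf s).spend (s.var 1) i) ∧
      (s'.var 13 ≠ 0 → s'.var 13 - 1 < s.var 0 ∧
        (stateOf s).spend (s.var 1) (s'.var 13 - 1) < s.var 12) ∧
      (s'.var 14 = 0 → ∀ i, k ≤ i → i < s.var 0 →
        (stateOf s).spend (s.var 1) i ≤ s.var 12 + (stateOf s).top (s.var 1) i) ∧
      (s'.var 14 ≠ 0 → ∃ i < s.var 0,
        s.var 12 + (stateOf s).top (s.var 1) i < (stateOf s).spend (s.var 1) i))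
    (by
      refine ⟨fun _ i h1 h2 => ?_, fun h => ?_, fun _ i h1 h2 => ?_, fun h => ?_⟩
      · simp at h1; omega
      · simp at h
      · simp at h1; omega
      · simp at h) (by
    intro k hk s₁ ha h₁
    have hk' : k < s.var 0 := by simpa using hk
    have e1 : s₁.var 1 = s.var 1 := (ha.1 1 (by decide)).trans (by simp)
    have e12 : s₁.var 12 = s.var 12 := (ha.1 12 (by decide)).trans (by simp)
    have ea : s₁.arr 1 = s.arr 1 := ha.2 1 (by decide)
    have eb : s₁.arr 3 = s.arr 3 := ha.2 3 (by decide)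
    have hst : stateOf (s₁.setVar 2 k) = stateOf s := by simp [stateOf, ea, eb, e12]
    have hs := scan_spec (s₁.setVar 2 k)
    have hag := agree_denote scanCmd (s₁.setVar 2 k)
    rw [hst] at hs
    simp only [Store.setVar_var, if_true, e1, reduceIte, OfNat.one_ne_ofNat] at hs
    set s₂ := scanCmd.denote (s₁.setVar 2 k) with hs₂
    have f2 : s₂.var 2 = k := (hag.1 2 (by decide)).trans (by simp)
    have f12 : s₂.var 12 = s.var 12 := (hag.1 12 (by decide)).trans (by simp [e12])
    have f13 : s₂.var 13 = s₁.var 13 := (hag.1 13 (by decide)).trans (by simp)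
    have f14 : s₂.var 14 = s₁.var 14 := (hag.1 14 (by decide)).trans (by simp)
    have hext : ∀ P : ℕ → Prop, P k → (∀ i, k + 1 ≤ i → i < s.var 0 → P i) →
        ∀ i, k ≤ i → i < s.var 0 → P i := by
      intro P hP h i hki hi
      rcases hki.eq_or_lt with rfl | h'
      exacts [hP, h i h' hi]
    obtain ⟨p1, p2, p3, p4⟩ := h₁
    simp only [denote, ← hs₂]
    by_cases c1 : (stateOf s).spend (s.var 1) k < s.var 12 <;>
    by_cases c2 : s.var 12 + (stateOf s).top (s.var 1) k < (stateOf s).spend (s.var 1) k <;>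
    simp [Expr.eval, BinOp.apply, hs.1, hs.2, f12, f2, f13, f14, c1, c2]
    · exact ⟨hk', k, hk', c2⟩
    · exact ⟨hk', fun h => hext _ (by omega) (p3 h), p4⟩
    · exact ⟨fun h => hext _ (by omega) (p1 h), p2, k, hk', c2⟩
    · exact ⟨fun h => hext _ (by omega) (p1 h), p2, fun h => hext _ (by omega) (p3 h), p4⟩)
  obtain ⟨p1, p2, p3, p4⟩ := this
  exact ⟨fun h i => p1 h i (Nat.zero_le _), p2, fun h i => p3 h i (Nat.zero_le _), p4⟩

/-- Ratios are compared by cross multiplication, which is transitive because prices are positive;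
good 0 is the first candidate. -/
theorem best_spec (s : Store) (hm : 0 < s.var 1) (hpos : ∀ j < s.var 1, 0 < s.arr 3 j) :
    (bestCmd.denote s).var 15 < s.var 1 ∧ ∀ j < s.var 1,
      s.arr 2 (s.var 2 * s.var 1 + j) * s.arr 3 ((bestCmd.denote s).var 15) ≤
        s.arr 2 (s.var 2 * s.var 1 + (bestCmd.denote s).var 15) * s.arr 3 j := by
  have := rep_induction (x := 3) (y := 1) (s := s.setVar 15 0)
    (c := ite (.op .lt (.op .mul (entry 2 2 15) (.get 3 (.var 3)))
      (.op .mul (entry 2 2 3) (.get 3 (.var 15)))) (assign 15 (.var 3)) skip)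
    (fun k s' => s'.var 15 < s.var 1 ∧ ∀ j, k ≤ j → j < s.var 1 →
      s.arr 2 (s.var 2 * s.var 1 + j) * s.arr 3 (s'.var 15) ≤
        s.arr 2 (s.var 2 * s.var 1 + s'.var 15) * s.arr 3 j)
    ⟨by simpa using hm, fun j h1 h2 => by simp at h1; omega⟩ (by
    intro k hk s₁ ha h₁
    have hk' : k < s.var 1 := by simpa using hk
    have e1 : s₁.var 1 = s.var 1 := (ha.1 1 (by decide)).trans (by simp)
    have e2 : s₁.var 2 = s.var 2 := (ha.1 2 (by decide)).trans (by simp)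
    have ea : s₁.arr 2 = s.arr 2 := ha.2 2 (by decide)
    have eb : s₁.arr 3 = s.arr 3 := ha.2 3 (by decide)
    by_cases hlt : s.arr 2 (s.var 2 * s.var 1 + s₁.var 15) * s.arr 3 k <
        s.arr 2 (s.var 2 * s.var 1 + k) * s.arr 3 (s₁.var 15)
    · simp [denote, Expr.eval, BinOp.apply, entry, e1, e2, ea, eb, hlt, hk']
      intro j hkj hj
      rcases hkj.eq_or_lt with rfl | h
      · exact le_rfl
      · have h2 := h₁.2 j h hj
        have hb := hpos _ h₁.1
        refine Nat.le_of_mul_le_mul_right ?_ hb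
        calc s.arr 2 (s.var 2 * s.var 1 + j) * s.arr 3 k * s.arr 3 (s₁.var 15)
            = s.arr 2 (s.var 2 * s.var 1 + j) * s.arr 3 (s₁.var 15) * s.arr 3 k := by ring
          _ ≤ s.arr 2 (s.var 2 * s.var 1 + s₁.var 15) * s.arr 3 j * s.arr 3 k :=
            Nat.mul_le_mul_right _ h2
          _ = s.arr 2 (s.var 2 * s.var 1 + s₁.var 15) * s.arr 3 k * s.arr 3 j := by ring
          _ ≤ s.arr 2 (s.var 2 * s.var 1 + k) * s.arr 3 (s₁.var 15) * s.arr 3 j :=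
            Nat.mul_le_mul_right _ hlt.le
          _ = _ := by ring
    · simp [denote, Expr.eval, BinOp.apply, entry, e1, e2, ea, eb, hlt]
      refine ⟨h₁.1, fun j hkj hj => ?_⟩
      rcases hkj.eq_or_lt with rfl | h
      · exact not_lt.1 hlt
      · exact h₁.2 j h hj)
  exact ⟨this.1, fun j hj => this.2 j (Nat.zero_le _) hj⟩

/-- The only link between program and auction: all facts about the auction are proved for the
relation `Step`, so the choice among several bidders or best goods is irrelevant. -/
theorem round_spec (s : Store) (hm : 0 < s.var 1) (hpos : ∀ j < s.var 1, 0 < s.arr 3 j) :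
    Step (s.var 0) (s.var 1) (fun i j => s.arr 2 (i * s.var 1 + j)) (stateOf s)
      (stateOf (roundCmd.denote s)) := by
  obtain ⟨p1, p2, p3, p4⟩ := check_spec s
  have hag := agree_denote checkCmd s
  simp only [roundCmd, denote]
  set s₁ := checkCmd.denote s
  have e1 : s₁.var 1 = s.var 1 := hag.1 1 (by decide)
  have e12 : s₁.var 12 = s.var 12 := hag.1 12 (by decide)
  have ea : s₁.arr = s.arr := funext fun a => hag.2 a (by
    simp [checkCmd, scanCmd, wa])
  by_cases h13 : s₁.var 13 = 0
  · by_cases h14 : s₁.var 14 = 0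
    · simp only [Expr.eval, h13, h14, ne_eq, not_true_eq_false, if_false]
      have : stateOf s₁ = stateOf s := by simp [stateOf, ea, e12]
      rw [this]
      exact .stay fun i hi => ⟨p1 h13 i hi, p3 h14 i hi⟩
    · simp only [Expr.eval, h13, h14, ne_eq, not_true_eq_false, if_false, not_false_eq_true,
        if_true]
      obtain ⟨i, hi, hviol⟩ := p4 h14
      have := Step.raise (st := stateOf s) (v := fun i j => s.arr 2 (i * s.var 1 + j)) hi (p1 h13) hviol
      simpa [stateOf, bumpExpr, Expr.eval, BinOp.apply, ea, e12, bump] using this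
  · simp only [Expr.eval, h13, ne_eq, not_false_eq_true, if_true]
    obtain ⟨hi, hpoor⟩ := p2 h13
    set i := s₁.var 13 - 1
    have hv : BinOp.apply .sub (s₁.var 13) 1 = i := rfl
    rw [hv]
    obtain ⟨hb1, hb2⟩ := best_spec (s₁.setVar 2 i) (by simpa [e1] using hm)
      (by simpa [e1, ea] using hpos)
    have hag' := agree_denote bestCmd (s₁.setVar 2 i)
    set s₂ := bestCmd.denote (s₁.setVar 2 i)
    have f2 : s₂.var 2 = i := (hag'.1 2 (by decide)).trans (by simp)
    have f12 : s₂.var 12 = s.var 12 := (hag'.1 12 (by decide)).trans (by simp [e12])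
    have fa : s₂.arr = s.arr := funext fun a => (hag'.2 a (by simp [bestCmd, wa])).trans
      (by simp [ea])
    simp [e1, ea] at hb1 hb2
    have := Step.bid (st := stateOf s) (v := fun i j => s.arr 2 (i * s.var 1 + j)) hi hb1 hpoor hb2
    simpa [stateOf, bumpExpr, Expr.eval, BinOp.apply, fa, f12, f2, bump] using this

theorem auction_spec {n m U : ℕ} {v : ℕ → ℕ → ℕ} (s : Store) (hn : s.var 0 = n)
    (hm : s.var 1 = m) (hv : ∀ i < n, ∀ j < m, v i j = s.arr 2 (i * m + j)) (hm0 : 0 < m)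
    (hnm : n ≤ m) (hvU : ∀ i < n, ∀ j < m, 1 ≤ v i j ∧ v i j ≤ U)
    (hI : Inv n m v U (stateOf s)) :
    Progress n m v U (s.var 6) (stateOf (auctionCmd.denote s)) := by
  have := rep_induction (x := 16) (y := 6) (s := s) (c := roundCmd)
    (fun k s' => k ≤ s.var 6 ∧ Progress n m v U (s.var 6 - k) (stateOf s'))
    (by simpa [stateOf] using hI.progress_zero) (by
    rintro k hk s₁ ha ⟨hk1, h₁⟩
    have e0 : s₁.var 0 = n := (ha.1 0 (by decide)).trans hn
    have e1 : s₁.var 1 = m := (ha.1 1 (by decide)).trans hm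
    have ea : s₁.arr 2 = s.arr 2 := ha.2 2 (by decide)
    have hst : stateOf (s₁.setVar 16 k) = stateOf s₁ := by simp [stateOf]
    have hr := round_spec (s₁.setVar 16 k) (by simpa [e1] using hm0) (by
      intro j hj
      have := h₁.1.price_ge j (by simpa [e1] using hj)
      simp only [stateOf] at this
      simp only [Store.setVar_arr]
      omega)
    rw [hst] at hr
    simp only [Store.setVar_var, Store.setVar_arr, e0, e1, ea, OfNat.zero_ne_ofNat, if_false,
      OfNat.one_ne_ofNat] at hr
    refine ⟨by omega, ?_⟩
    rw [show s.var 6 - k = s.var 6 - (k + 1) + 1 by omega]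
    exact h₁.step hnm hvU (hr.congr fun i hi j hj => (hv i hi j hj).symm))
  exact this.2

/-- The owners of the goods are agents throughout the auction. -/
theorem auction_owner_lt (s : Store) (hm : 0 < s.var 1)
    (h : ∀ j < s.var 1, s.arr 1 j < s.var 0 ∧ 0 < s.arr 3 j) :
    ∀ j < s.var 1, (auctionCmd.denote s).arr 1 j < s.var 0 := by
  -- `Progress` needs `n ≤ m`, but the output must be an allocation in any case, hence this weaker
  -- invariant. Positive prices are carried along for `round_spec`.
  have := rep_induction (x := 16) (y := 6) (s := s) (c := roundCmd)
    (fun _ s' => ∀ j < s.var 1, s'.arr 1 j < s.var 0 ∧ 0 < s'.arr 3 j)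
    (by simpa using h) (by
    intro k hk s₁ ha h₁
    have e0 : s₁.var 0 = s.var 0 := ha.1 0 (by decide)
    have e1 : s₁.var 1 = s.var 1 := ha.1 1 (by decide)
    have hr := round_spec (s₁.setVar 16 k) (by simpa [e1] using hm)
      (fun j hj => (h₁ j (by simpa [e1] using hj)).2)
    have hst : stateOf (s₁.setVar 16 k) = stateOf s₁ := by simp [stateOf]
    rw [hst] at hr
    have : ∀ st', Step (s.var 0) ((s₁.setVar 16 k).var 1)
        (fun i j => (s₁.setVar 16 k).arr 2 (i * (s₁.setVar 16 k).var 1 + j)) (stateOf s₁) st' →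
        ∀ j < s.var 1, st'.owner j < s.var 0 ∧ 0 < st'.price j := by
      intro st' hst'
      cases hst' with
      | stay _ => exact h₁
      | raise _ _ _ => exact h₁
      | bid hi hj _ _ =>
        rename_i i l _ _
        intro j hj'
        by_cases hjl : j = l
        · subst hjl
          simpa using ⟨hi, by unfold bump; omega⟩
        · simpa [hjl, stateOf] using h₁ j hj'
    exact this _ (by simpa [e0] using hr))
  exact fun j hj => (this j hj).1

end Auction

namespace Auction

open RAM RAM.Cmd Finset

/-! ### The initial state and the choice of constants -/

/-- When each price is the highest value of the good, all ratios are at most 1, with equality for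
the owner, so all goods are exactly best for their owners. Nobody has bid, so `fair` holds by its
second alternative. -/
theorem inv_of_highest {n m U : ℕ} {v : ℕ → ℕ → ℕ} {st : State} (hm : 0 < m)
    (hU : 1000 ≤ U) (hv : ∀ i < n, ∀ j < m, 1000 ≤ v i j ∧ v i j ≤ U)
    (hT : st.target = 1000)
    (h : ∀ j < m, st.owner j < n ∧ st.price j = v (st.owner j) j ∧
      ∀ i < n, v i j ≤ st.price j) : Inv n m v U st := by
  have hmU : U ≤ m * U := Nat.le_mul_of_pos_left _ hm
  have hle : ∀ j < m, st.price j ≤ U := fun j hj => by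
    rw [(h j hj).2.1]; exact (hv _ (h j hj).1 j hj).2
  refine ⟨fun j hj => (h j hj).1, fun j hj => ?_, hT.ge, fun j hj k hk => ?_,
    fun i _ => Or.inr fun j hj _ => hle j hj, by omega, fun j hj => (hle j hj).trans ?_⟩
  · rw [(h j hj).2.1]; exact (hv _ (h j hj).1 j hj).1
  · have h1 := Nat.mul_le_mul_right (st.price j) ((h k hk).2.2 _ (h j hj).1)
    rw [← (h j hj).2.1, mul_comm (st.price j) (st.price k)]
    omega
  · have h1 : m * U ≤ m * U ^ 2 := Nat.mul_le_mul_left _ (Nat.le_self_pow two_ne_zero U)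
    omega

/-- All factors are bounded by powers of `2 ^ B`, with total exponent `(n + 2) + (2 * n + 3) * m ≤ 8
* n * m`. This is the 8 in the 8000 rounds counted for each triple; the 1000 is the number of steps
per doubling. -/
theorem potential_bound {n m B U : ℕ} (hn : 0 < n) (hm : 0 < m) (hB : 4 * m < 2 ^ B)
    (hU : U = 2 ^ ((n + 1) * B)) :
    2 * (m * U) * (4 * (m * U ^ 2)) ^ m < 2 ^ (n * (m * (B * 8))) := by
  have hU0 : 0 < U := by rw [hU]; positivity
  have h1 : 2 * (m * U) < 2 ^ ((n + 2) * B) := by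
    calc 2 * (m * U) = 2 * m * U := by ring
      _ < 2 ^ B * U := Nat.mul_lt_mul_of_pos_right (by omega) hU0
      _ = _ := by rw [hU, ← pow_add]; ring_nf
  have h2 : 4 * (m * U ^ 2) ≤ 2 ^ ((2 * n + 3) * B) := by
    calc 4 * (m * U ^ 2) = 4 * m * U ^ 2 := by ring
      _ ≤ 2 ^ B * U ^ 2 := Nat.mul_le_mul_right _ hB.le
      _ = _ := by rw [hU, ← pow_mul, ← pow_add]; ring_nf
  calc 2 * (m * U) * (4 * (m * U ^ 2)) ^ m
      < 2 ^ ((n + 2) * B) * (4 * (m * U ^ 2)) ^ m :=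
        Nat.mul_lt_mul_of_pos_right h1 (by positivity)
    _ ≤ 2 ^ ((n + 2) * B) * (2 ^ ((2 * n + 3) * B)) ^ m :=
        Nat.mul_le_mul_left _ (Nat.pow_le_pow_left h2 m)
    _ = 2 ^ (((n + 2) + (2 * n + 3) * m) * B) := by rw [← pow_mul, ← pow_add]; ring_nf
    _ ≤ _ := by
        refine Nat.pow_le_pow_right two_pos ?_
        have h3 : n ≤ n * m := Nat.le_mul_of_pos_right _ hm
        have h4 : m ≤ n * m := Nat.le_mul_of_pos_left _ hn
        have h5 : (n + 2) + (2 * n + 3) * m ≤ 8 * (n * m) := by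
          have : (2 * n + 3) * m = 2 * (n * m) + 3 * m := by ring
          omega
        calc ((n + 2) + (2 * n + 3) * m) * B ≤ 8 * (n * m) * B := Nat.mul_le_mul_right _ h5
          _ = _ := by ring

/-- The preparation of the auction. -/
def setupCmd : Cmd := seq scaleCmd (seq countCmd initCmd)

/-- The store before the auction. -/
def setupStore (s : Store) : Store := setupCmd.denote ((size 5 4).denote (totalCmd.denote s))

/-- The store after the auction. -/
def finalStore (s : Store) : Store := auctionCmd.denote (setupStore s)

/-- A bound for all numbers in the input. -/
def total (n m : ℕ) (w : ℕ → ℕ → ℕ) : ℕ :=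
  ∑ i ∈ range n, ∑ j ∈ range m, (w i j + w i j + 1000000)

theorem setupStore_spec {n m B : ℕ} {w : ℕ → ℕ → ℕ} (s : Store) (hn0 : 0 < n)
    (hn : s.var 0 = n) (hm : s.var 1 = m) (h4 : s.var 4 = 0) (h6 : s.var 6 = 0)
    (hw : ∀ i j, s.arr 0 (i * m + j) = w i j) (hB : (total n m w).size = B) :
    (setupStore s).var 0 = n ∧ (setupStore s).var 1 = m ∧
    (setupStore s).var 6 = n * (m * (B * 8000)) ∧ (setupStore s).var 12 = 1000 ∧
    (∀ i < n, ∀ j < m, (setupStore s).arr 2 (i * m + j) = 2 ^ (n * B) * w i j + 1000) ∧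
    ∀ j < m, (setupStore s).arr 1 j < n ∧
      (setupStore s).arr 3 j = (setupStore s).arr 2 ((setupStore s).arr 1 j * m + j) ∧
      ∀ i < n, (setupStore s).arr 2 (i * m + j) ≤ (setupStore s).arr 3 j := by
  have hag₁ := agree_denote totalCmd s
  have h₁ := total_spec s
  simp only [hn, hm, h4, hw, zero_add] at h₁
  set s₁ := totalCmd.denote s with hs₁
  have hag₂ := agree_denote (size 5 4) s₁
  have h₂ : ((size 5 4).denote s₁).var 5 = B := by
    simp only [denote, Store.setVar_var, h₁]
    exact hB
  set s₂ := (size 5 4).denote s₁ with hs₂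
  have a0 : s₂.var 0 = n := ((hag₂.1 0 (by decide)).trans (hag₁.1 0 (by decide))).trans hn
  have a1 : s₂.var 1 = m := ((hag₂.1 1 (by decide)).trans (hag₁.1 1 (by decide))).trans hm
  have a6 : s₂.var 6 = 0 := ((hag₂.1 6 (by decide)).trans (hag₁.1 6 (by decide))).trans h6
  have aa : s₂.arr 0 = s.arr 0 := (hag₂.2 0 (by decide)).trans (hag₁.2 0 (by decide))
  have hag₃ := agree_denote scaleCmd s₂
  have h₃ : ∀ i < n, ∀ j < m,
      (scaleCmd.denote s₂).arr 2 (i * m + j) = 2 ^ (n * B) * w i j + 1000 := by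
    intro i hi j hj
    have := scale_spec s₂ (i := i) (j := j) (by rwa [a0]) (by rwa [a1])
    rwa [a0, a1, h₂, aa, hw] at this
  set s₃ := scaleCmd.denote s₂ with hs₃
  have hag₄ := agree_denote countCmd s₃
  have h₄ := count_spec s₃
  rw [hag₃.1 0 (by decide), hag₃.1 1 (by decide), hag₃.1 5 (by decide), hag₃.1 6 (by decide), a0,
    a1, a6, h₂, zero_add] at h₄
  set s₄ := countCmd.denote s₃ with hs₄
  have b0 : s₄.var 0 = n := ((hag₄.1 0 (by decide)).trans (hag₃.1 0 (by decide))).trans a0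
  have b1 : s₄.var 1 = m := ((hag₄.1 1 (by decide)).trans (hag₃.1 1 (by decide))).trans a1
  have ba : s₄.arr 2 = s₃.arr 2 := hag₄.2 2 (by decide)
  have hag₅ := agree_denote initCmd s₄
  have h₅ := init_spec s₄ (by rwa [b0]) (by
    intro i hi j hj
    rw [b0] at hi
    rw [b1] at hj
    rw [b1, ba, h₃ i hi j hj]
    omega)
  have hst : setupStore s = initCmd.denote s₄ := rfl
  rw [hst]
  have ca : (initCmd.denote s₄).arr 2 = s₄.arr 2 := hag₅.2 2 (by decide)
  rw [b0, b1] at h₅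
  rw [ca]
  refine ⟨(hag₅.1 0 (by decide)).trans b0, (hag₅.1 1 (by decide)).trans b1,
    (hag₅.1 6 (by decide)).trans h₄, h₅.1, ?_, h₅.2⟩
  rw [ba]
  exact h₃

theorem finalStore_owner_lt {n m : ℕ} {w : ℕ → ℕ → ℕ} (s : Store) (hn0 : 0 < n)
    (hn : s.var 0 = n) (hm : s.var 1 = m) (h4 : s.var 4 = 0) (h6 : s.var 6 = 0)
    (hw : ∀ i j, s.arr 0 (i * m + j) = w i j) :
    ∀ j < m, (finalStore s).arr 1 j < n := by
  intro j hj
  obtain ⟨e0, e1, -, -, e2, e3⟩ := setupStore_spec s hn0 hn hm h4 h6 hw rfl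
  have := auction_owner_lt (setupStore s) (by rw [e1]; omega) (by
    intro j hj
    rw [e1] at hj
    rw [e0]
    refine ⟨(e3 j hj).1, ?_⟩
    rw [(e3 j hj).2.1, e2 _ (e3 j hj).1 j hj]
    omega)
  rw [e0, e1] at this
  exact this j hj

/-- The auction solves the problem. -/
theorem finalStore_ratio {n m : ℕ} {w : ℕ → ℕ → ℕ} (s : Store) (hn0 : 0 < n) (hnm : n ≤ m)
    (hn : s.var 0 = n) (hm : s.var 1 = m) (h4 : s.var 4 = 0) (h6 : s.var 6 = 0)
    (hw : ∀ i j, s.arr 0 (i * m + j) = w i j) {y : ℕ → ℕ} (hy : ∀ j < m, y j < n) :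
    (∏ i ∈ range n, ∑ j ∈ range m with y j = i, (w i j : ℝ)) ≤
      1.45 ^ n * ∏ i ∈ range n, ∑ j ∈ range m with (finalStore s).arr 1 j = i, (w i j : ℝ) := by
  have hm0 : 0 < m := by omega
  obtain ⟨B, hB⟩ : ∃ B, (total n m w).size = B := ⟨_, rfl⟩
  obtain ⟨e0, e1, e6, e12, e2, e3⟩ := setupStore_spec s hn0 hn hm h4 h6 hw hB
  set V := ∑ i ∈ range n, ∑ j ∈ range m, w i j with hVdef
  have htot : total n m w = 2 * V + 1000000 * (n * m) := by
    simp only [total, sum_add_distrib, sum_const, card_range, smul_eq_mul]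
    ring
  have hSB : total n m w < 2 ^ B := hB ▸ Nat.lt_size_self _
  have hmn : m ≤ n * m := Nat.le_mul_of_pos_left _ hn0
  have hrow : ∀ i < n, ∑ j ∈ range m, w i j ≤ V := fun i hi =>
    single_le_sum (f := fun i => ∑ j ∈ range m, w i j) (fun _ _ => Nat.zero_le _)
      (mem_range.2 hi)
  set K := 2 ^ (n * B) with hK
  set U := 2 ^ ((n + 1) * B) with hU
  have hBK : 2 ^ B ≤ K := Nat.pow_le_pow_right two_pos (Nat.le_mul_of_pos_left _ hn0)
  have hUK : U = K * 2 ^ B := by rw [hU, hK, ← pow_add]; ring_nf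
  have hK0 : 0 < K := by positivity
  have hvU : ∀ i < n, ∀ j < m, 1000 ≤ K * w i j + 1000 ∧ K * w i j + 1000 ≤ U := by
    intro i hi j hj
    refine ⟨by omega, ?_⟩
    have h1 : w i j ≤ V := (single_le_sum (f := w i) (fun _ _ => Nat.zero_le _)
      (mem_range.2 hj)).trans (hrow i hi)
    calc K * w i j + 1000 ≤ K * w i j + K * 1000 := by
          have := Nat.le_mul_of_pos_left 1000 hK0; omega
      _ = K * (w i j + 1000) := by ring
      _ ≤ K * 2 ^ B := Nat.mul_le_mul_left _ (by omega)
      _ = U := hUK.symm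
  have hU1 : 1000 ≤ U := by
    rw [hUK]
    exact le_trans (by omega) (Nat.le_mul_of_pos_left _ hK0)
  have hI : Inv n m (fun i j => K * w i j + 1000) U (stateOf (setupStore s)) := by
    refine inv_of_highest hm0 hU1 hvU e12 fun j hj => ?_
    obtain ⟨f1, f2, f3⟩ := e3 j hj
    refine ⟨f1, ?_, fun i hi => ?_⟩
    · rw [e2 _ f1 j hj] at f2
      exact f2
    · have := f3 i hi
      rw [e2 i hi j hj] at this
      exact this
  have hP := auction_spec (setupStore s) e0 e1 (fun i hi j hj => (e2 i hi j hj).symm) hm0 hnm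
    (fun i hi j hj => ⟨by omega, (hvU i hi j hj).2⟩) hI
  rw [e6, show n * (m * (B * 8000)) = 1000 * (n * (m * (B * 8))) by ring] at hP
  have hF := hP.final (potential_bound hn0 hm0 (by omega) hU)
  have hratio := prod_value_le hP.1 hF hy
  refine prod_value_le_of_perturbed (K := K) (V := V) hn0 hrow ?_ (by omega) hratio
  -- `K` is the `n`-th power of `2 ^ B`, and `2 ^ B` exceeds `2 * (V + 1000 * m)`.
  rw [hK, mul_comm n B, pow_mul]
  exact Nat.pow_lt_pow_left (by omega) hn0.ne'

end Auction

/-! ## The main theorem -/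

namespace FairDivision

open Finset RAM

theorem prod_value_eq (I : FairDivision) {w : ℕ → ℕ → ℕ}
    (hw : ∀ (i : Fin I.n) (j : Fin I.m), w i j = I.v i j) (x : I.Allocation) {z : ℕ → ℕ}
    (hz : ∀ j : Fin I.m, z j = (x j : ℕ)) :
    (∏ i, (I.value i (I.bundle x i) : ℝ)) =
      ∏ i ∈ range I.n, ∑ j ∈ range I.m with z j = i, (w i j : ℝ) := by
  rw [Finset.prod_range]
  refine Finset.prod_congr rfl fun i _ => ?_
  rw [sum_filter, Finset.sum_range, value, bundle, sum_filter, Nat.cast_sum]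
  refine Finset.sum_congr rfl fun j _ => ?_
  simp only [hz, hw, Fin.ext_iff]
  split_ifs <;> simp

theorem nsw_nonneg (I : FairDivision) (x : I.Allocation) : 0 ≤ I.nsw x :=
  Real.rpow_nonneg (prod_nonneg fun _ _ => Nat.cast_nonneg _) _

/-- Some agent receives nothing, so in this case any output is optimal. -/
theorem nsw_eq_zero_of_lt (I : FairDivision) (h : I.m < I.n) (x : I.Allocation) :
    I.nsw x = 0 := by
  have hsurj : ¬ Function.Surjective x := fun hs => by
    have := Fintype.card_le_of_surjective x hs
    simp only [Fintype.card_fin] at this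
    omega
  obtain ⟨i, hi⟩ := not_forall.1 hsurj
  have hempty : I.bundle x i = ∅ := by
    ext j
    simp only [bundle, mem_filter, mem_univ, true_and, notMem_empty, iff_false]
    exact fun hj => hi ⟨j, hj⟩
  rw [nsw, prod_eq_zero (mem_univ i) (by simp [value, hempty])]
  -- The exponent must be nonzero, as `0 ^ 0 = 1`.
  refine Real.zero_rpow ?_
  have : (I.n : ℝ) ≠ 0 := by exact_mod_cast I.n_pos.ne'
  positivity

theorem nsw_le_of_prod_le (I : FairDivision) (x y : I.Allocation)
    (h : (∏ i, (I.value i (I.bundle y i) : ℝ)) ≤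
      1.45 ^ I.n * ∏ i, (I.value i (I.bundle x i) : ℝ)) :
    1 / 1.45 * I.nsw y ≤ I.nsw x := by
  have h0 : ∀ z : I.Allocation, (0 : ℝ) ≤ ∏ i, (I.value i (I.bundle z i) : ℝ) :=
    fun z => prod_nonneg fun _ _ => Nat.cast_nonneg _
  have h1 : I.nsw y ≤ 1.45 * I.nsw x := by
    unfold nsw
    refine (Real.rpow_le_rpow (h0 y) h (by positivity)).trans ?_
    rw [Real.mul_rpow (by positivity) (h0 x), one_div,
      Real.pow_rpow_inv_natCast (by norm_num) I.n_pos.ne']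
  rw [one_div, inv_mul_le_iff₀ (by norm_num)]
  exact h1

theorem size_le_inputLength (I : FairDivision) (i : Fin I.n) (j : Fin I.m) :
    (I.v i j).size ≤ I.inputLength := by
  have h1 : (I.v i j).size ≤ ∑ j, (I.v i j).size :=
    single_le_sum (f := fun j => (I.v i j).size) (fun _ _ => Nat.zero_le _) (mem_univ j)
  have h2 : ∑ j, (I.v i j).size ≤ ∑ i, ∑ j, (I.v i j).size :=
    single_le_sum (f := fun i => ∑ j, (I.v i j).size) (fun _ _ => Nat.zero_le _) (mem_univ i)
  unfold inputLength
  omega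

theorem small_input (I : FairDivision) : I.input.Small I.inputLength := by
  refine ⟨fun y => ?_, fun a k => ?_⟩
  · have := size_self_le I.n
    have := size_self_le I.m
    simp only [input, inputLength]
    split_ifs <;> simp <;> omega
  · simp only [input]
    split_ifs
    · exact I.size_le_inputLength _ _
    · simp
    · simp

theorem input_arr (I : FairDivision) (i : Fin I.n) (j : Fin I.m) :
    I.input.arr 0 (i * I.m + j) = I.v i j := by
  have hm : 0 < I.m := j.pos
  have h1 : ((i : ℕ) * I.m + j) / I.m = i := by
    rw [mul_comm, Nat.mul_add_div hm, Nat.div_eq_of_lt j.isLt, add_zero]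
  have h2 : ((i : ℕ) * I.m + j) % I.m = j := by
    rw [Nat.mul_add_mod_self_right, Nat.mod_eq_of_lt j.isLt]
  simp only [input, if_true]
  rw [dif_pos ⟨by rw [h1]; exact i.isLt, by rw [h2]; exact j.isLt⟩]
  congr 1 <;> exact Fin.ext (by assumption)

/-- The program that computes the allocation. -/
def solver : Program :=
  .seq Auction.totalCmd.compile (.seq (Cmd.size 5 4).compile
    (.seq Auction.setupCmd.compile Auction.auctionCmd.compile))

/-- The pieces are compiled and timed separately, because variables `5` and `6` are computed by
earlier pieces and bound loops of later ones, which `wf` forbids within one command. The bounds are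
chained by composing polynomials. -/
theorem run_solver : ∃ p : Polynomial ℕ, ∀ I : FairDivision,
    ∃ t, Run solver I.input t (Auction.finalStore I.input) ∧ t ≤ p.eval I.inputLength := by
  open Polynomial in
  let q : ℕ[X] := X + Auction.totalCmd.growth
  let p : ℕ[X] := Auction.totalCmd.time.comp (X + X) + (Cmd.size 5 4).time.comp q +
    Auction.setupCmd.time.comp (q + q) +
    Auction.auctionCmd.time.comp (q * (q * (q * 8000)) + q + (q + Auction.setupCmd.growth.comp q))
  refine ⟨p, fun I => ?_⟩
  set L := I.inputLength with hL
  have hnL : I.n ≤ L := by rw [hL, inputLength]; omega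
  have hmL : I.m ≤ L := by rw [hL, inputLength]; omega
  set s₀ := I.input
  have v0 : s₀.var 0 = I.n := rfl
  have v1 : s₀.var 1 = I.m := rfl
  obtain ⟨t₁, r₁, l₁, sm₁⟩ := Auction.totalCmd.run_compile (by decide) L L s₀ (by
    intro y hy
    have : y = 0 ∨ y = 1 := by simpa [Auction.totalCmd, Cmd.bounds] using hy
    rcases this with rfl | rfl
    exacts [hnL, hmL]) I.small_input
  have hag₁ := Auction.totalCmd.agree_denote s₀
  set s₁ := Auction.totalCmd.denote s₀
  set W := L + Auction.totalCmd.growth.eval L with hW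
  obtain ⟨t₂, r₂, l₂, sm₂⟩ := (Cmd.size 5 4).run_compile (by decide) 0 W s₁
    (by simp [Cmd.bounds]) sm₁
  have hag₂ := (Cmd.size 5 4).agree_denote s₁
  -- As the length of an entry, variable `5` is bounded by `W` as a number, and so may serve as a
  -- loop bound.
  have h5 : ((Cmd.size 5 4).denote s₁).var 5 ≤ W := by
    simpa [Cmd.denote] using sm₁.1 4
  set s₂ := (Cmd.size 5 4).denote s₁
  have a0 : s₂.var 0 = I.n := (hag₂.1 0 (by decide)).trans (hag₁.1 0 (by decide))
  have a1 : s₂.var 1 = I.m := (hag₂.1 1 (by decide)).trans (hag₁.1 1 (by decide))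
  have sm₂' : s₂.Small W := by simpa [Cmd.growth] using sm₂
  obtain ⟨t₃, r₃, l₃, sm₃⟩ := Auction.setupCmd.run_compile (by decide) W W s₂ (by
    intro y hy
    have : y = 0 ∨ y = 1 ∨ y = 5 := by
      have : y ∈ [0, 1, 5] := by
        have : ∀ y ∈ Auction.setupCmd.bounds, y ∈ [0, 1, 5] := by decide
        exact this y hy
      simpa using this
    rcases this with rfl | rfl | rfl
    · rw [a0]; omega
    · rw [a1]; omega
    · exact h5) sm₂'
  have hag₃ := Auction.setupCmd.agree_denote s₂
  -- For the number of rounds a bound on its length would not do; its explicit value `n * (m * (B *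
  -- 8000))` is needed.
  have h6 : (Auction.setupCmd.denote s₂).var 6 ≤ W * (W * (W * 8000)) := by
    obtain ⟨-, -, e6, -⟩ := Auction.setupStore_spec s₀ I.n_pos v0 v1 rfl rfl
      (fun _ _ => rfl) rfl
    have e6' : (Auction.setupCmd.denote s₂).var 6 = _ := e6
    rw [e6']
    have e5 : (Auction.total I.n I.m fun i j => s₀.arr 0 (i * I.m + j)).size = s₂.var 5 := by
      have h := Auction.total_spec s₀
      change _ = (s₁.var 4).size
      rw [h]
      simp only [v0, v1]
      rw [show s₀.var 4 = 0 from rfl, zero_add]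
      rfl
    rw [e5]
    exact Nat.mul_le_mul (by omega) (Nat.mul_le_mul (by omega) (Nat.mul_le_mul_right _ h5))
  set s₃ := Auction.setupCmd.denote s₂
  have b0 : s₃.var 0 = I.n := (hag₃.1 0 (by decide)).trans a0
  have b1 : s₃.var 1 = I.m := (hag₃.1 1 (by decide)).trans a1
  obtain ⟨t₄, r₄, l₄, -⟩ := Auction.auctionCmd.run_compile (by decide)
    (W * (W * (W * 8000)) + W) (W + Auction.setupCmd.growth.eval W) s₃ (by
    intro y hy
    have : y = 0 ∨ y = 1 ∨ y = 6 := by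
      have : y ∈ [0, 1, 6] := by
        have : ∀ y ∈ Auction.auctionCmd.bounds, y ∈ [0, 1, 6] := by decide
        exact this y hy
      simpa using this
    rcases this with rfl | rfl | rfl
    · rw [b0]; omega
    · rw [b1]; omega
    · omega) sm₃
  refine ⟨_, r₁.seq (r₂.seq (r₃.seq r₄)), ?_⟩
  have hq : q.eval L = W := by simp [q, hW]
  simp only [p, Polynomial.eval_add, Polynomial.eval_comp, Polynomial.eval_mul, Polynomial.eval_X,
    Polynomial.eval_ofNat, hq]
  rw [zero_add] at l₂
  omega

end FairDivision

theorem mainTheorem3 :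
    ∃ (P : RAM.Program) (p : Polynomial ℕ), ∀ I : FairDivision,
      ∃ (t : ℕ) (s : RAM.Store) (x : I.Allocation),
        RAM.Run P I.input t s ∧ t ≤ p.eval I.inputLength ∧ I.IsOutput s x ∧
          ∀ y : I.Allocation, 1 / 1.45 * I.nsw y ≤ I.nsw x := by
  obtain ⟨p, hp⟩ := FairDivision.run_solver
  refine ⟨FairDivision.solver, p, fun I => ?_⟩
  obtain ⟨t, hrun, ht⟩ := hp I
  have howner := Auction.finalStore_owner_lt I.input I.n_pos rfl rfl rfl rfl (fun _ _ => rfl)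
  let x : I.Allocation := fun j => ⟨(Auction.finalStore I.input).arr 1 j, howner j j.isLt⟩
  refine ⟨t, _, x, hrun, ht, fun j => rfl, fun y => ?_⟩
  rcases Nat.lt_or_ge I.m I.n with hmn | hnm
  · rw [I.nsw_eq_zero_of_lt hmn y, mul_zero]
    exact I.nsw_nonneg x
  · refine I.nsw_le_of_prod_le x y ?_
    let z : ℕ → ℕ := fun j => if h : j < I.m then y ⟨j, h⟩ else 0
    let w : ℕ → ℕ → ℕ := fun i j => I.input.arr 0 (i * I.m + j)
    rw [I.prod_value_eq (w := w) I.input_arr x (z := (Auction.finalStore I.input).arr 1) fun j => rfl,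
      I.prod_value_eq (w := w) I.input_arr y (z := z) fun j => by simp [z]]
    refine Auction.finalStore_ratio I.input I.n_pos hnm rfl rfl rfl rfl (fun _ _ => rfl)
      fun j hj => ?_
    simp only [z, dif_pos hj]
    exact (y ⟨j, hj⟩).isLt
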